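/- For $\gamma>0$ and $\beta\ge 0$ consider the pendulum system $$\dot\phi=z,\qquad \dot z=\beta-\sin\phi-\gamma z. \tag{1}$$ For $0\le\beta\le1$ put $A_0=(-\pi-\arcsin\beta,0)$ and $A_1=(\pi-\arcsin\beta,0)$; these are consecutive equilibria (saddles if $\beta<1$). Let $R(\beta)$ denote the trajectory of (1) that departs from $A_0$ into the upper half plane, i.e. that tends to $A_0$ as $t\to-\infty$ and has $z>0$ for all sufficiently negative $t$. Call $\beta\in[0,1]$ *critical* for $\gamma$ if $R(\beta)$ tends to $A_1$ as $t\to+\infty$. A *periodic solution* $z=z(\phi)$ is a nowhere vanishing function on $\mathbb R$ with $z(\phi+2\pi)=z(\phi)$ and $\dfrac{dz}{d\phi}=\dfrac{\beta-\sin\phi}{z}-\gamma$. A *cycle on the cylinder* is a non-constant solution $(\phi(t),z(t))$ of (1) for which there are $T>0$ and $n\in\mathbb Z$ with $\phi(t+T)=\phi(t)+2\pi n$ and $z(t+T)=z(t)$ for all $t$; the integer $n$ is its winding number. **Theorem.** Let $\gamma_1>0$. (a) There is a critical value $\beta_0=\beta_0(\gamma_1)$ for $\gamma_1$ with $0<\beta_0\le1$;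 the trajectory $R(\beta_0)$ lies entirely in $\{z>0\}$ and runs from $A_0$ into $A_1$. (b) $\beta_0(\gamma_1)$ is the only critical value in $[0,1]$ for $\gamma_1$. (c) For $\gamma=\gamma_1$ and every $\beta>\beta_0(\gamma_1)$ there is a periodic solution $z_T(\phi)$ with $z_T(\phi)>0$ for all $\phi\in\mathbb R$, and its graph is traversed by a cycle on the cylinder with winding number $1$. For $0\le\beta<\beta_0(\gamma_1)$ there is no periodic solution $z(\phi)$, and no cycle on the cylinder of any winding number. (d) For $\gamma=\gamma_1$ and $\beta\ge0$, if a periodic solution $z_T(\phi)$ exists, then it is the only one, every cycle on the cylinder lies on its graph, and it is an orbitally stable limit cycle: for every $\varepsilon>0$ there is $\delta>0$ such that each solution of (1) starting at distance less than $\delta$ from the graph of $z_T$ stays at distance less than $\varepsilon$ from it for all $t\ge0$; and there is $\delta>0$ such that for each solution starting at distance less than $\delta$ from the graph, this distance tends to $0$ as $t\to+\infty$. (e) If $\beta_0(\gamma_1)=1$, then $\beta_0(\gamma_2)=1$ for every $\gamma_2>\gamma_1$. -/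

import Mathlib

open Filter Topology

/-- `(φ, z)` is a solution, on the whole time axis, of the damped driven pendulum system
`φ' = z`, `z' = β - sin φ - γ z`.  (The vector field is globally Lipschitz, so every solution
extends to the whole time axis.) -/
structure IsPendulumSolution (γ β : ℝ) (φ z : ℝ → ℝ) : Prop where
  deriv_phi : ∀ t, HasDerivAt φ (z t) t
  deriv_z : ∀ t, HasDerivAt z (β - Real.sin (φ t) - γ * z t) t

/-- The singular point `A₀ = (-π - arcsin β, 0)` (used for `0 ≤ β ≤ 1`). -/
noncomputable def saddleA0 (β : ℝ) : ℝ × ℝ := (-Real.pi - Real.arcsin β, 0)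

/-- The next singular point `A₁ = (π - arcsin β, 0)` (used for `0 ≤ β ≤ 1`). -/
noncomputable def saddleA1 (β : ℝ) : ℝ × ℝ := (Real.pi - Real.arcsin β, 0)

/-- `(φ, z)` parametrizes the trajectory `R(β)` departing from `A₀` into the upper half plane:
it is a solution that emanates from `A₀` (as `t → -∞`) and has `z > 0` near `A₀`. -/
structure IsDepartingTrajectory (γ β : ℝ) (φ z : ℝ → ℝ) : Prop where
  sol : IsPendulumSolution γ β φ z
  tendsto_A0 : Tendsto (fun t => (φ t, z t)) atBot (𝓝 (saddleA0 β))
  upper : ∀ᶠ t in atBot, 0 < z t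

/-- `β` is a critical drive for the friction `γ`: the singular points exist, and a trajectory
departing from `A₀` into the upper half plane runs into `A₁`. -/
def IsCriticalDrive (γ β : ℝ) : Prop :=
  0 ≤ β ∧ β ≤ 1 ∧ ∃ φ z : ℝ → ℝ, IsDepartingTrajectory γ β φ z ∧
    Tendsto (fun t => (φ t, z t)) atTop (𝓝 (saddleA1 β))

/-- `z = z(φ)` is a `2π`-periodic solution of the orbit equation
`dz/dφ = (β - sin φ) / z - γ` on the whole line. A trajectory that is a graph over the whole
`φ`-axis never meets `z = 0`. -/
structure IsPeriodicGraph (γ β : ℝ) (z : ℝ → ℝ) : Prop where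
  ne_zero : ∀ φ, z φ ≠ 0
  deriv : ∀ φ, HasDerivAt z ((β - Real.sin φ) / z φ - γ) φ
  periodic : Function.Periodic z (2 * Real.pi)

/-- `(φ, z)` is a non-constant solution that is periodic on the cylinder (`φ` modulo `2π`) and
winds `n` times around it in one period. Here `n = 0` is an ordinary closed orbit (a cycle of the
first kind), and `n ≠ 0` is a rotational cycle (of the second kind). -/
structure IsCylinderCycle (γ β : ℝ) (n : ℤ) (φ z : ℝ → ℝ) : Prop where
  sol : IsPendulumSolution γ β φ z
  nonconstant : ¬ ∃ a b : ℝ, ∀ t, φ t = a ∧ z t = b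
  periodic : ∃ T : ℝ, 0 < T ∧
    ∀ t, φ (t + T) = φ t + 2 * Real.pi * (n : ℝ) ∧ z (t + T) = z t

/-- The graph of `z`; for a `2π`-periodic `z` it is the full lift to the plane of a closed curve
on the cylinder, so planar distance to it is distance to that curve on the cylinder. -/
def graphCurve (z : ℝ → ℝ) : Set (ℝ × ℝ) := {p | p.2 = z p.1}

/-- Asymptotic orbital stability of the closed curve `graphCurve zT` on the cylinder: solutions
that start close to the curve stay close to it, and they converge to it as `t → ∞`. -/
structure IsStableLimitCycle (γ β : ℝ) (zT : ℝ → ℝ) : Prop where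
  stable : ∀ ε > 0, ∃ δ > 0, ∀ φ z : ℝ → ℝ, IsPendulumSolution γ β φ z →
    Metric.infDist (φ 0, z 0) (graphCurve zT) < δ →
    ∀ t, 0 ≤ t → Metric.infDist (φ t, z t) (graphCurve zT) < ε
  attracting : ∃ δ > 0, ∀ φ z : ℝ → ℝ, IsPendulumSolution γ β φ z →
    Metric.infDist (φ 0, z 0) (graphCurve zT) < δ →
    Tendsto (fun t => Metric.infDist (φ t, z t) (graphCurve zT)) atTop (𝓝 0)

/-!
Read an orbit in the upper half plane as a graph `z = y(φ)`; then `y² / 2` has derivative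
`β - sin φ - γ y`, an equation without denominators that also makes sense where `y` vanishes. At a
minimum of the difference of the squares of two periodic graphs the two derivatives agree, which
compares the velocities with the forces there; so graphs are unique and increase with `β`, and every
drive above one that carries a positive graph carries one too. The critical drive `β₀` is the
infimum of the drives that carry a positive graph. It carries none itself, since a positive graph
survives a slight decrease of the drive. The positive graphs for `β ↓ β₀` are uniformly Lipschitz
and decrease to a graph for `β₀` that touches zero, and this can only happen at the saddles:
the limit graph is the connection from `A₀` to `A₁`.

Everything else compares a motion `(φ, z)` with a graph through the gap `y(φ)² / 2 - z² / 2`. When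
both belong to the same drive the square of the gap is a Lyapunov function, and it decays
exponentially near a positive graph: this gives the uniqueness and stability of the cycle and forces
the departing trajectory at `β₀` onto the limit graph. When the drives differ, the minimum of the
gap along a connection or a cycle excludes drives below `β₀`.
-/

section Calculus

variable {f f' : ℝ → ℝ}

theorem exists_forall_le_of_periodic {T : ℝ} (hp : Function.Periodic f T) (hT : T ≠ 0)
    (hf : Continuous f) : ∃ x, ∀ y, f x ≤ f y := by
  obtain ⟨_, ⟨x, rfl⟩, hx⟩ :=
    (hp.compact_of_continuous hT hf).exists_isLeast (Set.range_nonempty f)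
  exact ⟨x, fun y => hx ⟨y, rfl⟩⟩

theorem exists_forall_ge_of_periodic {T : ℝ} (hp : Function.Periodic f T) (hT : T ≠ 0)
    (hf : Continuous f) : ∃ x, ∀ y, f y ≤ f x := by
  obtain ⟨_, ⟨x, rfl⟩, hx⟩ :=
    (hp.compact_of_continuous hT hf).exists_isGreatest (Set.range_nonempty f)
  exact ⟨x, fun y => hx ⟨y, rfl⟩⟩

theorem continuous_of_forall_hasDerivAt (hf : ∀ t, HasDerivAt f (f' t) t) : Continuous f :=
  continuous_iff_continuousAt.2 fun t => (hf t).continuousAt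

theorem exists_forall_le_and_deriv_eq_zero_of_periodic {T : ℝ} (hp : Function.Periodic f T)
    (hT : T ≠ 0) (hf : ∀ t, HasDerivAt f (f' t) t) : ∃ m, (∀ x, f m ≤ f x) ∧ f' m = 0 := by
  obtain ⟨m, hm⟩ := exists_forall_le_of_periodic hp hT (continuous_of_forall_hasDerivAt hf)
  exact ⟨m, hm, IsLocalMin.hasDerivAt_eq_zero (Eventually.of_forall hm) (hf m)⟩

theorem exists_forall_ge_and_deriv_eq_zero_of_periodic {T : ℝ} (hp : Function.Periodic f T)
    (hT : T ≠ 0) (hf : ∀ t, HasDerivAt f (f' t) t) : ∃ m, (∀ x, f x ≤ f m) ∧ f' m = 0 := by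
  obtain ⟨m, hm⟩ := exists_forall_ge_of_periodic hp hT (continuous_of_forall_hasDerivAt hf)
  exact ⟨m, hm, IsLocalMax.hasDerivAt_eq_zero (Eventually.of_forall hm) (hf m)⟩

theorem exists_forall_le_and_deriv_eq_zero_of_tendsto (hf : ∀ t, HasDerivAt f (f' t) t)
    {L₁ L₂ t₀ : ℝ} (hbot : Tendsto f atBot (𝓝 L₁)) (htop : Tendsto f atTop (𝓝 L₂))
    (hL₁ : f t₀ < L₁) (hL₂ : f t₀ < L₂) : ∃ m, (∀ t, f m ≤ f t) ∧ f' m = 0 := by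
  obtain ⟨m, hm⟩ := (continuous_of_forall_hasDerivAt hf).exists_forall_le' t₀ (by
    rw [cocompact_eq_atBot_atTop]
    exact eventually_sup.2 ⟨(hbot.eventually_const_lt hL₁).mono fun _ h => h.le,
      (htop.eventually_const_lt hL₂).mono fun _ h => h.le⟩)
  exact ⟨m, hm, IsLocalMin.hasDerivAt_eq_zero (Eventually.of_forall hm) (hf m)⟩

theorem antitoneOn_of_hasDerivAt_nonpos {s : Set ℝ} (hs : Convex ℝ s)
    (hf : ∀ t, HasDerivAt f (f' t) t) (hf' : ∀ t ∈ interior s, f' t ≤ 0) : AntitoneOn f s :=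
  antitoneOn_of_hasDerivWithinAt_nonpos hs (continuous_of_forall_hasDerivAt hf).continuousOn
    (fun t _ => (hf t).hasDerivWithinAt) hf'

theorem deriv_eq_zero_of_forall_eq (hf : ∀ t, HasDerivAt f (f' t) t) {c : ℝ} {s : Set ℝ}
    (hs : IsOpen s) (hfs : ∀ t ∈ s, f t = c) {t : ℝ} (ht : t ∈ s) : f' t = 0 :=
  (hf t).unique <| (hasDerivAt_const t c).congr_of_eventuallyEq <|
    Filter.mem_of_superset (hs.mem_nhds ht) hfs

theorem exists_last_zero (hf : Continuous f) {a b : ℝ} (hab : a ≤ b) (ha : 0 ≤ f a)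
    (hb : f b < 0) : ∃ m ∈ Set.Ico a b, f m = 0 ∧ ∀ t ∈ Set.Ioc m b, f t < 0 := by
  have hcompact : IsCompact (Set.Icc a b ∩ {t | 0 ≤ f t}) :=
    isCompact_Icc.inter_right (isClosed_le continuous_const hf)
  obtain ⟨m, ⟨hm, hm0⟩, hmax⟩ := hcompact.exists_isGreatest ⟨a, ⟨le_rfl, hab⟩, ha⟩
  obtain ⟨c, hc, hfc⟩ := intermediate_value_Icc' hm.2 hf.continuousOn ⟨hb.le, hm0⟩
  have hcm : c = m := le_antisymm (hmax ⟨⟨hm.1.trans hc.1, hc.2⟩, hfc.ge⟩) hc.1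
  have hmb : m ≠ b := by rintro rfl; exact hb.not_ge hm0
  refine ⟨m, ⟨hm.1, lt_of_le_of_ne hm.2 hmb⟩, hcm ▸ hfc, fun t ht => ?_⟩
  by_contra! h
  exact ht.1.not_ge (hmax ⟨⟨hm.1.trans ht.1.le, ht.2⟩, h⟩)

theorem exists_first_zero (hf : Continuous f) {a b : ℝ} (hab : a ≤ b) (ha : 0 < f a)
    (hb : f b ≤ 0) : ∃ m ∈ Set.Ioc a b, f m = 0 ∧ ∀ t ∈ Set.Ico a m, 0 < f t := by
  obtain ⟨m, hm, hm0, hneg⟩ := exists_last_zero (f := fun t => -f (-t)) (a := -b) (b := -a)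
    (by fun_prop) (by linarith) (by simpa using hb) (by simpa using ha)
  refine ⟨-m, ⟨by linarith [hm.2], by linarith [hm.1]⟩, by simpa using hm0, fun t ht => ?_⟩
  simpa using hneg (-t) ⟨by linarith [ht.2], by linarith [ht.1]⟩

theorem tendsto_add_linear_of_periodic {S k : ℝ} (hp : Function.Periodic f S) (hS : S ≠ 0)
    (hf : Continuous f) (hk : 0 < k) :
    Tendsto (fun t => f t + k * t) atTop atTop ∧ Tendsto (fun t => f t + k * t) atBot atBot := by
  obtain ⟨l, hl⟩ := exists_forall_le_of_periodic hp hS hf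
  obtain ⟨u, hu⟩ := exists_forall_ge_of_periodic hp hS hf
  exact ⟨tendsto_atTop_add_left_of_le _ _ hl (tendsto_id.const_mul_atTop hk),
    tendsto_atBot_add_left_of_ge _ _ hu (tendsto_id.const_mul_atBot hk)⟩

theorem tendsto_of_add_eq_add {S c : ℝ} (hS : 0 < S) (hc : 0 < c) (hf : Continuous f)
    (hadd : ∀ t, f (t + S) = f t + c) : Tendsto f atTop atTop ∧ Tendsto f atBot atBot := by
  have hp : Function.Periodic (fun t => f t - c / S * t) S := fun t => by
    simp only [hadd]
    field_simp
    ring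
  simpa using tendsto_add_linear_of_periodic hp hS.ne' (by fun_prop) (div_pos hc hS)

theorem eq_zero_of_tendsto_of_hasDerivAt_atTop {L M : ℝ} (hf : ∀ t, HasDerivAt f (f' t) t)
    (hL : Tendsto f atTop (𝓝 L)) (hM : Tendsto f' atTop (𝓝 M)) : M = 0 := by
  choose c hc hslope using fun t : ℝ =>
    exists_hasDerivAt_eq_slope f f' (lt_add_one t) (continuous_of_forall_hasDerivAt hf).continuousOn
      fun s _ => hf s
  have hctop : Tendsto c atTop atTop := tendsto_atTop_mono (fun t => (hc t).1.le) tendsto_id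
  have hdiff : Tendsto (fun t => f (t + 1) - f t) atTop (𝓝 (L - L)) :=
    (hL.comp (tendsto_atTop_add_const_right _ 1 tendsto_id)).sub hL
  rw [sub_self] at hdiff
  refine tendsto_nhds_unique (hM.comp hctop) (hdiff.congr fun t => ?_)
  simp [hslope t]

theorem eq_zero_of_tendsto_of_hasDerivAt_atBot {L M : ℝ} (hf : ∀ t, HasDerivAt f (f' t) t)
    (hL : Tendsto f atBot (𝓝 L)) (hM : Tendsto f' atBot (𝓝 M)) : M = 0 :=
  neg_eq_zero.1 <| eq_zero_of_tendsto_of_hasDerivAt_atTop (f := fun t => f (-t))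
    (f' := fun t => -f' (-t)) (fun t => ((hf (-t)).comp t (hasDerivAt_neg t)).congr_deriv (by simp))
    (hL.comp tendsto_neg_atTop_atBot) (hM.comp tendsto_neg_atTop_atBot).neg

theorem le_mul_exp_of_deriv_le {k : ℝ} (hf : ∀ t, HasDerivAt f (f' t) t)
    (hf' : ∀ t, 0 ≤ t → f' t ≤ -k * f t) {t : ℝ} (ht : 0 ≤ t) :
    f t ≤ f 0 * Real.exp (-k * t) := by
  have hderiv : ∀ t, HasDerivAt (fun t => f t * Real.exp (k * t))
      ((f' t + k * f t) * Real.exp (k * t)) t := fun t => by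
    refine ((hf t).mul ((hasDerivAt_id t).const_mul k).exp).congr_deriv ?_
    simp only [id]
    ring
  have hanti := antitoneOn_of_hasDerivAt_nonpos (convex_Ici 0) hderiv fun t ht => by
    rw [interior_Ici] at ht
    exact mul_nonpos_of_nonpos_of_nonneg (by linarith [hf' t (le_of_lt ht)]) (Real.exp_pos _).le
  have h := hanti Set.self_mem_Ici ht ht
  simp only [mul_zero, Real.exp_zero, mul_one] at h
  rwa [neg_mul, Real.exp_neg, ← div_eq_mul_inv, le_div_iff₀ (Real.exp_pos _)]

end Calculus

section ODE

variable {E : Type*} [NormedAddCommGroup E] [NormedSpace ℝ E] {f : ℝ → E → E} {K M : NNReal}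

theorem solution_unique (hf : ∀ t, LipschitzWith K (f t)) {x y : ℝ → E}
    (hx : ∀ t, HasDerivAt x (f t (x t)) t) (hy : ∀ t, HasDerivAt y (f t (y t)) t) {t₀ : ℝ}
    (h : x t₀ = y t₀) : x = y :=
  ODE_solution_unique_univ (s := fun _ => Set.univ) (fun t => (hf t).lipschitzOnWith)
    (fun t => ⟨hx t, trivial⟩) (fun t => ⟨hy t, trivial⟩) h

theorem exists_local_solution [CompleteSpace E] (hf : ∀ t, LipschitzWith K (f t))
    (hc : ∀ x, Continuous fun t => f t x) (hM : ∀ t x, ‖f t x‖ ≤ M) (x₀ : E) {r : ℝ}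
    (hr : 0 < r) : ∃ x : ℝ → E, x 0 = x₀ ∧ ∀ t ∈ Set.Ioo (-r) r, HasDerivAt x (f t (x t)) t := by
  have h0 : (0 : ℝ) ∈ Set.Icc (-r) r := ⟨by linarith, hr.le⟩
  have hp : IsPicardLindelof f (⟨0, h0⟩ : Set.Icc (-r) r) x₀ (M * r.toNNReal) 0 M K :=
    { lipschitzOnWith := fun t _ => (hf t).lipschitzOnWith
      continuousOn := fun x _ => (hc x).continuousOn
      norm_le := fun t _ x _ => hM t x
      mul_max_le := by simp [hr.le] }
  obtain ⟨x, hx0, hx⟩ := hp.exists_eq_forall_mem_Icc_hasDerivWithinAt₀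
  exact ⟨x, hx0, fun t ht => (hx t (Set.Ioo_subset_Icc_self ht)).hasDerivAt
    (Icc_mem_nhds ht.1 ht.2)⟩

theorem exists_global_solution [CompleteSpace E] (hf : ∀ t, LipschitzWith K (f t))
    (hc : ∀ x, Continuous fun t => f t x) (hM : ∀ t x, ‖f t x‖ ≤ M) (x₀ : E) :
    ∃ x : ℝ → E, x 0 = x₀ ∧ ∀ t, HasDerivAt x (f t (x t)) t := by
  choose x hx0 hx using fun n : ℕ =>
    exists_local_solution hf hc hM x₀ (show (0 : ℝ) < n + 1 by positivity)
  have hagree : ∀ {m n : ℕ}, m ≤ n → ∀ t ∈ Set.Ioo (-((m : ℝ) + 1)) (m + 1), x m t = x n t := by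
    intro m n hmn
    have hsub : Set.Ioo (-((m : ℝ) + 1)) (m + 1) ⊆ Set.Ioo (-((n : ℝ) + 1)) (n + 1) :=
      Set.Ioo_subset_Ioo (by gcongr) (by gcongr)
    exact ODE_solution_unique_of_mem_Ioo (v := f) (s := fun _ => Set.univ) (t₀ := 0)
      (fun t _ => (hf t).lipschitzOnWith) ⟨by linarith [m.cast_nonneg (α := ℝ)], by positivity⟩
      (fun t ht => ⟨hx m t ht, trivial⟩) (fun t ht => ⟨hx n t (hsub ht), trivial⟩)
      (by rw [hx0, hx0])
  have hmem : ∀ t : ℝ, t ∈ Set.Ioo (-((⌈|t|⌉₊ : ℝ) + 1)) (⌈|t|⌉₊ + 1) := fun t =>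
    abs_lt.1 (by linarith [Nat.le_ceil |t|])
  refine ⟨fun t => x ⌈|t|⌉₊ t, hx0 _, fun t => ?_⟩
  refine (hx _ t (hmem t)).congr_of_eventuallyEq ?_
  filter_upwards [Ioo_mem_nhds (hmem t).1 (hmem t).2] with s hs
  rcases le_total ⌈|s|⌉₊ ⌈|t|⌉₊ with h | h
  · exact hagree h s (hmem s)
  · exact (hagree h s hs).symm

theorem norm_sub_le_of_norm_deriv_le (hM : ∀ t x, ‖f t x‖ ≤ M) {x : ℝ → E}
    (hx : ∀ t, HasDerivAt x (f t (x t)) t) (s t : ℝ) : ‖x t - x s‖ ≤ M * |t - s| :=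
  convex_univ.norm_image_sub_le_of_norm_hasDerivWithin_le
    (fun t _ => (hx t).hasDerivWithinAt) (fun _ _ => hM _ _) (Set.mem_univ s) (Set.mem_univ t)

theorem continuous_solution_of_initial_value {Q : E → ℝ → E} {T : ℝ} (hT : 0 ≤ T)
    (hf : ∀ t, LipschitzWith K (f t)) (hQ0 : ∀ c, Q c 0 = c)
    (hQ : ∀ c t, HasDerivAt (Q c) (f t (Q c t)) t) : Continuous fun c => Q c T := by
  refine (LipschitzWith.of_dist_le_mul (K := (Real.exp (K * (T - 0))).toNNReal)
    fun c d => ?_).continuous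
  rw [Real.coe_toNNReal _ (Real.exp_pos _).le, mul_comm (Real.exp _)]
  exact dist_le_of_trajectories_ODE (v := f) (a := 0) (b := T) hf
    (fun t _ => (hQ c t).continuousAt.continuousWithinAt) (fun t _ => (hQ c t).hasDerivWithinAt)
    (fun t _ => (hQ d t).continuousAt.continuousWithinAt) (fun t _ => (hQ d t).hasDerivWithinAt)
    (by rw [hQ0, hQ0]) T ⟨hT, le_rfl⟩

end ODE

-- A fixed point of the Poincaré map `x 0 ↦ x T` exists by the intermediate value theorem.
theorem exists_periodic_solution {f : ℝ → ℝ → ℝ} {K M : NNReal} {T r R : ℝ} (hT : 0 ≤ T)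
    (hf : ∀ t, LipschitzWith K (f t)) (hc : ∀ x, Continuous fun t => f t x)
    (hM : ∀ t x, |f t x| ≤ M) (hper : ∀ t, f (t + T) = f t)
    (hlow : ∀ x : ℝ → ℝ, (∀ t, HasDerivAt x (f t (x t)) t) → (∀ t ∈ Set.Icc 0 T, x t ≤ r) →
      x 0 ≤ x T)
    (hhigh : ∀ x : ℝ → ℝ, (∀ t, HasDerivAt x (f t (x t)) t) → (∀ t ∈ Set.Icc 0 T, R ≤ x t) →
      x T ≤ x 0) :
    ∃ x : ℝ → ℝ, Function.Periodic x T ∧ ∀ t, HasDerivAt x (f t (x t)) t := by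
  choose Q hQ0 hQ using exists_global_solution hf hc hM
  have hdist : ∀ c, ∀ t ∈ Set.Icc 0 T, |Q c t - c| ≤ M * T := fun c t ht => by
    have h := norm_sub_le_of_norm_deriv_le hM (hQ c) 0 t
    rw [hQ0, sub_zero, abs_of_nonneg ht.1, Real.norm_eq_abs] at h
    exact h.trans (by gcongr; exact ht.2)
  obtain ⟨c, hcT⟩ : ∃ c, Q c T - c = 0 := by
    refine mem_range_of_exists_le_of_exists_ge (f := fun c => Q c T - c)
      ((continuous_solution_of_initial_value hT hf hQ0 hQ).sub continuous_id)
      ⟨R + M * T, ?_⟩ ⟨r - M * T, ?_⟩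
    · have := hhigh _ (hQ (R + M * T)) fun t ht => by
        linarith [(abs_le.1 (hdist (R + M * T) t ht)).1]
      rw [hQ0] at this
      linarith
    · have := hlow _ (hQ (r - M * T)) fun t ht => by
        linarith [(abs_le.1 (hdist (r - M * T) t ht)).2]
      rw [hQ0] at this
      linarith
  have hshift : (fun t => Q c (t + T)) = Q c := by
    refine solution_unique hf (t₀ := 0) (fun t => ?_) (hQ c) ?_
    · simpa only [hper] using (hQ c (t + T)).comp_add_const t T
    · rw [zero_add, hQ0]
      linarith
  exact ⟨Q c, congrFun hshift, hQ c⟩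

section AutonomousFlow

variable {g φ : ℝ → ℝ} {K M : NNReal} {s₀ s₁ x₀ : ℝ}

theorem eq_const_of_autonomous (hg : LipschitzWith K g) (hφ : ∀ t, HasDerivAt φ (g (φ t)) t)
    {t₀ : ℝ} (h : g (φ t₀) = 0) (t : ℝ) : φ t = φ t₀ :=
  congrFun (solution_unique (f := fun _ => g) (t₀ := t₀) (fun _ => hg) hφ
    (y := fun _ => φ t₀) (fun s => by simpa only [h] using hasDerivAt_const s (φ t₀)) rfl) t

theorem mem_Ioo_of_autonomous (hg : LipschitzWith K g) (hφ : ∀ t, HasDerivAt φ (g (φ t)) t)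
    (h₀ : g s₀ = 0) (h₁ : g s₁ = 0) (h : φ 0 ∈ Set.Ioo s₀ s₁) (t : ℝ) :
    φ t ∈ Set.Ioo s₀ s₁ := by
  have hcont : Continuous φ := continuous_of_forall_hasDerivAt hφ
  have havoid : ∀ {s}, g s = 0 → s ≠ φ 0 → s ∉ Set.range φ := by
    rintro _ hs hne ⟨r, rfl⟩
    exact hne (eq_const_of_autonomous hg hφ hs 0).symm
  constructor
  · by_contra! hle
    exact havoid h₀ h.1.ne (mem_range_of_exists_le_of_exists_ge hcont ⟨t, hle⟩ ⟨0, h.1.le⟩)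
  · by_contra! hle
    exact havoid h₁ h.2.ne' (mem_range_of_exists_le_of_exists_ge hcont ⟨0, h.2.le⟩ ⟨t, hle⟩)

theorem exists_flow_between_zeros (hg : LipschitzWith K g) (hM : ∀ x, |g x| ≤ M)
    (h₀ : g s₀ = 0) (h₁ : g s₁ = 0) (hpos : ∀ x ∈ Set.Ioo s₀ s₁, 0 < g x)
    (hx₀ : x₀ ∈ Set.Ioo s₀ s₁) :
    ∃ φ : ℝ → ℝ, φ 0 = x₀ ∧ (∀ t, HasDerivAt φ (g (φ t)) t) ∧ (∀ t, φ t ∈ Set.Ioo s₀ s₁) ∧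
      Tendsto φ atBot (𝓝 s₀) ∧ Tendsto φ atTop (𝓝 s₁) := by
  obtain ⟨φ, rfl, hφ⟩ := exists_global_solution (f := fun _ => g) (fun _ => hg)
    (fun _ => continuous_const) (fun _ => hM) x₀
  have hmem := mem_Ioo_of_autonomous hg hφ h₀ h₁ hx₀
  have hmono : Monotone φ := monotone_of_hasDerivAt_nonneg hφ fun t => (hpos _ (hmem t)).le
  have hbddAbove : BddAbove (Set.range φ) := ⟨s₁, by rintro _ ⟨t, rfl⟩; exact (hmem t).2.le⟩
  have hbddBelow : BddBelow (Set.range φ) := ⟨s₀, by rintro _ ⟨t, rfl⟩; exact (hmem t).1.le⟩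
  have htop := tendsto_atTop_ciSup hmono hbddAbove
  have hbot := tendsto_atBot_ciInf hmono hbddBelow
  have hsup : ⨆ t, φ t = s₁ := by
    have hzero : g (⨆ t, φ t) = 0 :=
      eq_zero_of_tendsto_of_hasDerivAt_atTop hφ htop ((hg.continuous.tendsto _).comp htop)
    refine le_antisymm (ciSup_le fun t => (hmem t).2.le) (not_lt.1 fun hlt => ?_)
    exact (hpos _ ⟨(hmem 0).1.trans_le (le_ciSup hbddAbove 0), hlt⟩).ne' hzero
  have hinf : ⨅ t, φ t = s₀ := by
    have hzero : g (⨅ t, φ t) = 0 :=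
      eq_zero_of_tendsto_of_hasDerivAt_atBot hφ hbot ((hg.continuous.tendsto _).comp hbot)
    refine le_antisymm (not_lt.1 fun hlt => ?_) (le_ciInf fun t => (hmem t).1.le)
    exact (hpos _ ⟨hlt, (ciInf_le hbddBelow 0).trans_lt (hmem 0).2⟩).ne' hzero
  exact ⟨φ, rfl, hφ, hmem, hinf ▸ hbot, hsup ▸ htop⟩

theorem exists_flow_add_period {T : ℝ} (hT : 0 < T) (hg : LipschitzWith K g)
    (hp : Function.Periodic g T) (hpos : ∀ x, 0 < g x) :
    ∃ φ : ℝ → ℝ, (∀ t, HasDerivAt φ (g (φ t)) t) ∧ ∃ S > 0, ∀ t, φ (t + S) = φ t + T := by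
  obtain ⟨m, hm⟩ := exists_forall_le_of_periodic hp hT.ne' hg.continuous
  obtain ⟨u, hu⟩ := exists_forall_ge_of_periodic hp hT.ne' hg.continuous
  obtain ⟨φ, hφ0, hφ⟩ := exists_global_solution (f := fun _ => g) (M := ⟨g u, (hpos u).le⟩)
    (fun _ => hg) (fun _ => continuous_const)
    (fun _ x => (abs_of_pos (hpos x)).trans_le (hu x)) 0
  have hcont := continuous_of_forall_hasDerivAt hφ
  have hgrowth : g m * (T / g m) ≤ φ (T / g m) := by
    have hmono : Monotone fun t => φ t - g m * t := monotone_of_hasDerivAt_nonneg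
      (fun t => (hφ t).sub (by simpa using (hasDerivAt_id t).const_mul (g m)))
      fun t => sub_nonneg.2 (hm (φ t))
    have := hmono (div_nonneg hT.le (hpos m).le)
    simp only [hφ0] at this
    linarith
  rw [mul_div_cancel₀ _ (hpos m).ne'] at hgrowth
  obtain ⟨S, hS, hST⟩ := intermediate_value_Icc (div_nonneg hT.le (hpos m).le) hcont.continuousOn
    ⟨hφ0.trans_le hT.le, hgrowth⟩
  have hS0 : S ≠ 0 := by
    rintro rfl
    exact hT.ne (hφ0.symm.trans hST)
  refine ⟨φ, hφ, S, lt_of_le_of_ne hS.1 hS0.symm, fun t => ?_⟩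
  have hshift : (fun t => φ (t + S) - T) = φ := by
    refine solution_unique (f := fun _ => g) (t₀ := 0) (fun _ => hg) (fun s => ?_) hφ ?_
    · simpa only [hp.sub_eq] using ((hφ (s + S)).comp_add_const s S).sub_const T
    · simp [hST, hφ0]
  linarith [congrFun hshift t]

end AutonomousFlow

/-- `(φ, z)` is the position and velocity of a particle on the line moving in the force field `F`
under linear friction `γ`. The pendulum system is the case `F = β - sin`. -/
structure IsDampedMotion (γ : ℝ) (F φ z : ℝ → ℝ) : Prop where
  deriv_phi : ∀ t, HasDerivAt φ (z t) t
  deriv_z : ∀ t, HasDerivAt z (F (φ t) - γ * z t) t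

/-- The mechanical energy of a particle at `x` with velocity `v` in the force field `F`; the
potential is normalized to vanish at the origin. -/
noncomputable def mechanicalEnergy (F : ℝ → ℝ) (x v : ℝ) : ℝ := v ^ 2 / 2 - ∫ s in 0..x, F s

section mechanicalEnergy

variable {F : ℝ → ℝ}

theorem tendsto_mechanicalEnergy {ι : Type*} {l : Filter ι} {φ z : ι → ℝ} {x v : ℝ}
    (hF : Continuous F) (hφ : Tendsto φ l (𝓝 x)) (hz : Tendsto z l (𝓝 v)) :
    Tendsto (fun t => mechanicalEnergy F (φ t) (z t)) l (𝓝 (mechanicalEnergy F x v)) :=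
  have hprim : Continuous fun x => ∫ s in 0..x, F s :=
    intervalIntegral.continuous_primitive (fun a b => hF.intervalIntegrable a b) 0
  ((hz.pow 2).div_const 2).sub ((hprim.tendsto x).comp hφ)

theorem mechanicalEnergy_zero_le_of_integral_nonneg {s x : ℝ} (hF : Continuous F)
    (h : 0 ≤ ∫ r in s..x, F r) (v : ℝ) : mechanicalEnergy F x 0 ≤ mechanicalEnergy F s v := by
  have hadd := intervalIntegral.integral_add_adjacent_intervals
    (hF.intervalIntegrable (μ := MeasureTheory.volume) 0 s) (hF.intervalIntegrable s x)
  unfold mechanicalEnergy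
  nlinarith [sq_nonneg v]

theorem mechanicalEnergy_add_zsmul {T : ℝ} (hF : Continuous F) (hp : Function.Periodic F T)
    (n : ℤ) (x v : ℝ) :
    mechanicalEnergy F (x + n • T) v = mechanicalEnergy F x v - n • ∫ s in 0..T, F s := by
  have hadd := intervalIntegral.integral_add_adjacent_intervals
    (hF.intervalIntegrable (μ := MeasureTheory.volume) 0 x) (hF.intervalIntegrable x (x + n • T))
  have hper := hp.intervalIntegral_add_zsmul_eq n x fun a b => hF.intervalIntegrable a b
  unfold mechanicalEnergy
  rw [← hadd, hper, hp.intervalIntegral_add_eq x 0, zero_add]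
  ring

end mechanicalEnergy

namespace IsDampedMotion

variable {γ : ℝ} {F φ z φ₂ z₂ : ℝ → ℝ}

theorem continuous_phi (h : IsDampedMotion γ F φ z) : Continuous φ :=
  continuous_of_forall_hasDerivAt h.deriv_phi

theorem continuous_z (h : IsDampedMotion γ F φ z) : Continuous z :=
  continuous_of_forall_hasDerivAt h.deriv_z

theorem comp_add_const (h : IsDampedMotion γ F φ z) (c : ℝ) :
    IsDampedMotion γ F (fun t => φ (t + c)) (fun t => z (t + c)) :=
  ⟨fun t => (h.deriv_phi (t + c)).comp_add_const t c,
    fun t => (h.deriv_z (t + c)).comp_add_const t c⟩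

theorem unique {K : NNReal} (hF : LipschitzWith K F) (h : IsDampedMotion γ F φ z)
    (h₂ : IsDampedMotion γ F φ₂ z₂) {t₀ : ℝ} (hφ : φ t₀ = φ₂ t₀) (hz : z t₀ = z₂ t₀) :
    φ = φ₂ ∧ z = z₂ := by
  have hfield := LipschitzWith.prod_snd.prodMk
    ((hF.comp (LipschitzWith.prod_fst (α := ℝ) (β := ℝ))).sub
      ((lipschitzWith_smul γ).comp (LipschitzWith.prod_snd (α := ℝ) (β := ℝ))))
  have heq := solution_unique (f := fun _ (p : ℝ × ℝ) => (p.2, F p.1 - γ * p.2)) (t₀ := t₀)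
    (fun _ => hfield) (fun t => (h.deriv_phi t).prodMk (h.deriv_z t))
    (fun t => (h₂.deriv_phi t).prodMk (h₂.deriv_z t)) (Prod.ext hφ hz)
  exact ⟨funext fun t => congrArg Prod.fst (congrFun heq t),
    funext fun t => congrArg Prod.snd (congrFun heq t)⟩

theorem velocity_eq_zero_of_force_eq_zero {K : NNReal} (hF : LipschitzWith K F)
    (h : IsDampedMotion γ F φ z) {t₀ : ℝ} (hz : z t₀ = 0) (hφ : F (φ t₀) = 0) (t : ℝ) :
    z t = 0 := by
  have hrest : IsDampedMotion γ F (fun _ => φ t₀) (fun _ => 0) :=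
    ⟨fun s => hasDerivAt_const s _, fun s => by simpa [hφ] using hasDerivAt_const s (0 : ℝ)⟩
  exact congrFun (h.unique hF hrest (t₀ := t₀) rfl hz).2 t

theorem exists_velocity_neg {K : NNReal} (hF : LipschitzWith K F) (h : IsDampedMotion γ F φ z)
    (hmov : ∃ t, z t ≠ 0) {t₀ : ℝ} (hz : z t₀ ≤ 0) : ∃ t, z t < 0 := by
  by_contra! hnonneg
  have hz₀ : z t₀ = 0 := le_antisymm hz (hnonneg t₀)
  have hmin : IsLocalMin z t₀ := Eventually.of_forall fun t => hz₀.trans_le (hnonneg t)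
  have hforce : F (φ t₀) = 0 := by simpa [hz₀] using hmin.hasDerivAt_eq_zero (h.deriv_z t₀)
  obtain ⟨t, ht⟩ := hmov
  exact ht (h.velocity_eq_zero_of_force_eq_zero hF hz₀ hforce t)

theorem hasDerivAt_energy (hF : Continuous F) (h : IsDampedMotion γ F φ z) (t : ℝ) :
    HasDerivAt (fun t => mechanicalEnergy F (φ t) (z t)) (-(γ * z t ^ 2)) t := by
  have hprim : HasDerivAt (fun x => ∫ s in 0..x, F s) (F (φ t)) (φ t) :=
    intervalIntegral.integral_hasDerivAt_right (hF.intervalIntegrable _ _)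
      hF.stronglyMeasurable.stronglyMeasurableAtFilter hF.continuousAt
  refine ((((h.deriv_z t).pow 2).div_const 2).sub (hprim.comp t (h.deriv_phi t))).congr_deriv ?_
  norm_num
  ring

theorem antitone_energy (hγ : 0 ≤ γ) (hF : Continuous F) (h : IsDampedMotion γ F φ z) :
    Antitone fun t => mechanicalEnergy F (φ t) (z t) :=
  antitone_of_hasDerivAt_nonpos (h.hasDerivAt_energy hF) fun t =>
    neg_nonpos.2 (mul_nonneg hγ (sq_nonneg (z t)))

theorem velocity_eq_zero_of_energy_le {K : NNReal} (hγ : 0 < γ) (hF : LipschitzWith K F)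
    (h : IsDampedMotion γ F φ z) {t₁ t₂ : ℝ} (ht : t₁ < t₂)
    (hE : mechanicalEnergy F (φ t₁) (z t₁) ≤ mechanicalEnergy F (φ t₂) (z t₂)) (t : ℝ) :
    z t = 0 := by
  have hanti := h.antitone_energy hγ.le hF.continuous
  have hrest : ∀ s ∈ Set.Ioo t₁ t₂, z s = 0 := fun s hs => by
    have := deriv_eq_zero_of_forall_eq (h.hasDerivAt_energy hF.continuous) isOpen_Ioo
      (fun r hr => le_antisymm (hanti hr.1.le) (hE.trans (hanti hr.2.le))) hs
    simpa [hγ.ne'] using this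
  obtain ⟨m, hm⟩ := exists_between ht
  have hforce : F (φ m) - γ * z m = 0 := deriv_eq_zero_of_forall_eq h.deriv_z isOpen_Ioo hrest hm
  exact h.velocity_eq_zero_of_force_eq_zero hF (hrest m hm) (by simpa [hrest m hm] using hforce) t

theorem winding_pos {K : NNReal} {T : ℝ} (hγ : 0 < γ) (hF : LipschitzWith K F)
    (hFp : Function.Periodic F T) (hint : 0 ≤ ∫ s in 0..T, F s) (h : IsDampedMotion γ F φ z)
    (hmov : ∃ t, z t ≠ 0) {t₁ t₂ : ℝ} (ht : t₁ < t₂) {n : ℤ} (hφ : φ t₂ = φ t₁ + n • T)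
    (hz : z t₂ = z t₁) : 0 < n := by
  obtain ⟨t, hmov⟩ := hmov
  by_contra! hn
  refine hmov (h.velocity_eq_zero_of_energy_le hγ hF ht ?_ t)
  rw [hφ, hz, mechanicalEnergy_add_zsmul hF.continuous hFp]
  exact le_sub_self_iff _ |>.2 (smul_nonpos_of_nonpos_of_nonneg hn hint)

theorem velocity_eq_zero_of_return {K : NNReal} (hγ : 0 < γ) (hF : LipschitzWith K F)
    (h : IsDampedMotion γ F φ z) {t₁ t₂ : ℝ} (ht : t₁ < t₂) (hz : z t₁ = 0)
    (hφ : φ t₂ = φ t₁) (t : ℝ) : z t = 0 := by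
  refine h.velocity_eq_zero_of_energy_le hγ hF ht ?_ t
  rw [hz, hφ]
  exact mechanicalEnergy_zero_le_of_integral_nonneg hF.continuous (by simp) _

theorem exists_turning_point {K : NNReal} (hγ : 0 < γ) (hF : LipschitzWith K F)
    (h : IsDampedMotion γ F φ z) {t₀ t₁ : ℝ} (ht : t₀ ≤ t₁) (hz₀ : 0 < z t₀) (hz₁ : z t₁ < 0) :
    ∃ m, z m = 0 ∧ ∀ t, m < t → φ t < φ m := by
  obtain ⟨m, hm, hzm, hneg⟩ := exists_last_zero h.continuous_z ht hz₀.le hz₁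
  have hreturn : ∀ t, m < t → φ t ≠ φ m := fun t hmt hφ =>
    hz₀.ne' (h.velocity_eq_zero_of_return hγ hF hmt hzm hφ t₀)
  have hanti := antitoneOn_of_hasDerivAt_nonpos (convex_Icc m t₁) h.deriv_phi fun s hs =>
    (hneg s (by rw [interior_Icc] at hs; exact ⟨hs.1, hs.2.le⟩)).le
  have hφt₁ : φ t₁ ≤ φ m := hanti ⟨le_rfl, hm.2.le⟩ ⟨hm.2.le, le_rfl⟩ hm.2.le
  refine ⟨m, hzm, fun t hmt => ?_⟩
  by_contra! hle
  obtain ⟨r, hr, hφr⟩ := intermediate_value_uIcc (a := t₁) (b := t) h.continuous_phi.continuousOn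
    (Set.mem_uIcc_of_le hφt₁ hle)
  exact hreturn r ((lt_min hm.2 hmt).trans_le hr.1) hφr

theorem velocity_pos_of_tendsto {K : NNReal} (hγ : 0 < γ) (hF : LipschitzWith K F)
    (h : IsDampedMotion γ F φ z) (hup : ∀ᶠ t in atBot, 0 < z t) {s : ℝ}
    (hφ : Tendsto φ atTop (𝓝 s)) (hz : Tendsto z atTop (𝓝 0))
    (hs : ∀ x, s ≤ x → 0 ≤ ∫ r in s..x, F r) (t : ℝ) : 0 < z t := by
  by_contra! hzt
  obtain ⟨t₂, hmov⟩ := hup.exists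
  obtain ⟨t₁, hzt₁⟩ := h.exists_velocity_neg hF ⟨t₂, hmov.ne'⟩ hzt
  obtain ⟨t₀, hzt₀, ht₀⟩ := (hup.and (eventually_le_atBot t₁)).exists
  obtain ⟨m, hzm, hback⟩ := h.exists_turning_point hγ hF ht₀ hzt₀ hzt₁
  have hsm : s ≤ φ m := le_of_tendsto hφ ((eventually_gt_atTop m).mono fun t ht => (hback t ht).le)
  have hE : mechanicalEnergy F s 0 ≤ mechanicalEnergy F (φ (m + 1)) (z (m + 1)) :=
    (h.antitone_energy hγ.le hF.continuous).le_of_tendsto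
      (tendsto_mechanicalEnergy hF.continuous hφ hz) (m + 1)
  refine hmov.ne' (h.velocity_eq_zero_of_energy_le hγ hF (lt_add_one m) ?_ t₂)
  rw [hzm]
  exact (mechanicalEnergy_zero_le_of_integral_nonneg hF.continuous (hs _ hsm) 0).trans hE

end IsDampedMotion

theorem exists_deriv_pos_of_tendsto_atBot {f f' : ℝ → ℝ} (hf : ∀ t, HasDerivAt f (f' t) t)
    (hbot : Tendsto f atBot atBot) (t₁ : ℝ) : ∃ t₀ ≤ t₁, 0 < f' t₀ := by
  by_contra! hnonpos
  have hanti : AntitoneOn f (Set.Iic t₁) :=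
    antitoneOn_of_hasDerivAt_nonpos (convex_Iic t₁) hf fun s hs =>
      hnonpos s (by simpa using interior_subset hs)
  obtain ⟨r, hr, hrt₁⟩ := ((hbot.eventually_lt_atBot (f t₁)).and (eventually_le_atBot t₁)).exists
  exact hr.not_ge (hanti hrt₁ Set.self_mem_Iic hrt₁)

theorem IsDampedMotion.velocity_pos_of_add_eq_add {γ S c : ℝ} {F φ z : ℝ → ℝ} {K : NNReal}
    (hγ : 0 < γ) (hF : LipschitzWith K F) (h : IsDampedMotion γ F φ z) (hS : 0 < S) (hc : 0 < c)
    (hadd : ∀ t, φ (t + S) = φ t + c) (t : ℝ) : 0 < z t := by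
  obtain ⟨htop, hbot⟩ := tendsto_of_add_eq_add hS hc h.continuous_phi hadd
  by_contra! hzt
  obtain ⟨t₂, -, hmov⟩ := exists_deriv_pos_of_tendsto_atBot h.deriv_phi hbot 0
  obtain ⟨t₁, hzt₁⟩ := h.exists_velocity_neg hF ⟨t₂, hmov.ne'⟩ hzt
  obtain ⟨t₀, ht₀, hzt₀⟩ := exists_deriv_pos_of_tendsto_atBot h.deriv_phi hbot t₁
  obtain ⟨m, -, hback⟩ := h.exists_turning_point hγ hF ht₀ hzt₀ hzt₁
  obtain ⟨r, hr, hmr⟩ := ((htop.eventually_gt_atTop (φ m)).and (eventually_gt_atTop m)).exists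
  exact hr.not_gt (hback r hmr)

/-- `y` is the nonnegative `T`-periodic velocity profile `z = y(φ)` of an orbit of the damped
motion in the force field `F`. The orbit equation `y y' = F - γ y` is written for `y² / 2`, so that
it makes sense at the zeros of `y` too. -/
structure IsOrbitGraph (γ T : ℝ) (F y : ℝ → ℝ) : Prop where
  nonneg : ∀ x, 0 ≤ y x
  periodic : Function.Periodic y T
  deriv_sq : ∀ x, HasDerivAt (fun x => y x ^ 2 / 2) (F x - γ * y x) x

namespace IsOrbitGraph

variable {γ γ' T : ℝ} {F G y w : ℝ → ℝ}

theorem sqrt_sq_eq (h : IsOrbitGraph γ T F y) : (fun x => √(2 * (y x ^ 2 / 2))) = y := by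
  funext x
  rw [mul_div_cancel₀ _ two_ne_zero, Real.sqrt_sq (h.nonneg x)]

theorem continuous (h : IsOrbitGraph γ T F y) : Continuous y := by
  rw [← h.sqrt_sq_eq]
  exact (continuous_const.mul (continuous_of_forall_hasDerivAt h.deriv_sq)).sqrt

theorem hasDerivAt (h : IsOrbitGraph γ T F y) {x : ℝ} (hx : 0 < y x) :
    HasDerivAt y (F x / y x - γ) x := by
  have hsqrt := ((h.deriv_sq x).const_mul 2).sqrt (by positivity)
  rw [h.sqrt_sq_eq, mul_div_cancel₀ _ two_ne_zero, Real.sqrt_sq hx.le] at hsqrt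
  refine hsqrt.congr_deriv ?_
  field_simp

theorem of_hasDerivAt (hpos : ∀ x, 0 < y x) (hp : Function.Periodic y T)
    (hy : ∀ x, HasDerivAt y (F x / y x - γ) x) : IsOrbitGraph γ T F y where
  nonneg x := (hpos x).le
  periodic := hp
  deriv_sq x := by
    refine (((hy x).pow 2).div_const 2).congr_deriv ?_
    have := (hpos x).ne'
    field_simp
    ring

theorem change_damping (h : IsOrbitGraph γ T F y) :
    IsOrbitGraph γ' T (fun x => F x + (γ' - γ) * y x) y :=
  ⟨h.nonneg, h.periodic, fun x => (h.deriv_sq x).congr_deriv (by ring)⟩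

theorem integral_force (hF : Continuous F) (h : IsOrbitGraph γ T F y) :
    ∫ x in 0..T, F x = γ * ∫ x in 0..T, y x := by
  have hint : ∀ {f : ℝ → ℝ}, Continuous f → IntervalIntegrable f MeasureTheory.volume 0 T :=
    fun hf => hf.intervalIntegrable _ _
  have hnet := intervalIntegral.integral_eq_sub_of_hasDerivAt (a := 0) (b := T)
    (fun x _ => h.deriv_sq x) (hint (hF.sub (h.continuous.const_mul γ)))
  rw [h.periodic.eq, sub_self, intervalIntegral.integral_sub (hint hF)
    (hint (h.continuous.const_mul γ)), intervalIntegral.integral_const_mul] at hnet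
  exact sub_eq_zero.1 hnet

theorem exists_pos_of_force_ne_zero (h : IsOrbitGraph γ T F y) {x₀ : ℝ} (hx₀ : F x₀ ≠ 0) :
    ∃ x, 0 < y x := by
  by_contra! hle
  have hy : ∀ x, y x = 0 := fun x => le_antisymm (hle x) (h.nonneg x)
  refine hx₀ ?_
  simpa [hy] using deriv_eq_zero_of_forall_eq h.deriv_sq isOpen_univ (c := 0)
    (fun x _ => by simp [hy]) (Set.mem_univ x₀)

theorem integral_force_pos (hγ : 0 < γ) (hT : 0 < T) (hF : Continuous F)
    (h : IsOrbitGraph γ T F y) {x₀ : ℝ} (hx₀ : F x₀ ≠ 0) : 0 < ∫ x in 0..T, F x := by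
  obtain ⟨x, hx⟩ := h.exists_pos_of_force_ne_zero hx₀
  obtain ⟨c, hc, hyc⟩ := h.periodic.exists_mem_Ico₀ hT x
  rw [h.integral_force hF]
  exact mul_pos hγ (intervalIntegral.integral_pos hT h.continuous.continuousOn
    (fun x _ => h.nonneg x) ⟨c, Set.Ico_subset_Icc_self hc, hyc ▸ hx⟩)

theorem exists_touching_point (hT : T ≠ 0) (hy : IsOrbitGraph γ T F y)
    (hw : IsOrbitGraph γ T G w) :
    ∃ m, (∀ x, y m ^ 2 - w m ^ 2 ≤ y x ^ 2 - w x ^ 2) ∧ γ * (y m - w m) = F m - G m := by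
  obtain ⟨m, hmin, hm⟩ := exists_forall_le_and_deriv_eq_zero_of_periodic
    (f := fun x => y x ^ 2 / 2 - w x ^ 2 / 2) (fun x => by simp only [hy.periodic x, hw.periodic x])
    hT fun x => (hy.deriv_sq x).sub (hw.deriv_sq x)
  exact ⟨m, fun x => by linarith [hmin x], by linarith⟩

theorem le_of_force_le (hγ : 0 < γ) (hT : T ≠ 0) (hw : IsOrbitGraph γ T G w)
    (hy : IsOrbitGraph γ T F y) (hGF : ∀ x, G x ≤ F x) (x : ℝ) : w x ≤ y x := by
  obtain ⟨m, hmin, hm⟩ := hy.exists_touching_point hT hw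
  have hwy : w m ≤ y m :=
    sub_nonneg.1 (nonneg_of_mul_nonneg_right (hm.trans_ge (sub_nonneg.2 (hGF m))) hγ)
  exact le_of_sq_le_sq (by linarith [hmin x, pow_le_pow_left₀ (hw.nonneg m) hwy 2]) (hy.nonneg x)

theorem eq (hγ : 0 < γ) (hT : T ≠ 0) (hy : IsOrbitGraph γ T F y) (hw : IsOrbitGraph γ T F w) :
    y = w :=
  funext fun x => le_antisymm (hy.le_of_force_le hγ hT hw (fun _ => le_rfl) x)
    (hw.le_of_force_le hγ hT hy (fun _ => le_rfl) x)

theorem abs_force_le {c : ℝ} {F' : ℝ → ℝ} (hγ : 0 < γ) (hc : 0 ≤ c) (hT : T ≠ 0)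
    (hFp : Function.Periodic F T) (hF : ∀ x, HasDerivAt F (F' x) x) (hF' : ∀ x, |F' x| ≤ c ^ 2)
    (h : IsOrbitGraph γ T F y) (hpos : ∀ x, 0 < y x) (x : ℝ) : |F x| ≤ (c + γ) * y x := by
  have hbound : ∀ ε : ℝ, ε = 1 ∨ ε = -1 → ε * F x ≤ (c + γ) * y x := by
    intro ε hε
    obtain ⟨m, hmin, hm⟩ := exists_forall_le_and_deriv_eq_zero_of_periodic
      (f := fun x => (c + γ) * y x - ε * F x) (fun x => by simp only [h.periodic x, hFp x]) hT
      fun x => ((h.hasDerivAt (hpos x)).const_mul _).sub ((hF x).const_mul ε)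
    suffices ε * F m ≤ (c + γ) * y m by linarith [hmin x]
    by_contra! hlt
    have hslope : c + γ < ε * (F m / y m) := by rwa [← mul_div_assoc, lt_div_iff₀ (hpos m)]
    have hF'm := abs_le.1 (hF' m)
    have hsteep := mul_pos (show 0 < c + γ by linarith) (sub_pos.2 hslope)
    rcases hε with rfl | rfl <;> nlinarith [mul_nonneg hc hγ.le]
  exact abs_le.2 ⟨by linarith [hbound (-1) (Or.inr rfl)], by linarith [hbound 1 (Or.inl rfl)]⟩

theorem lipschitzWith {c : ℝ} {F' : ℝ → ℝ} (hγ : 0 < γ) (hc : 0 ≤ c) (hT : T ≠ 0)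
    (hFp : Function.Periodic F T) (hF : ∀ x, HasDerivAt F (F' x) x) (hF' : ∀ x, |F' x| ≤ c ^ 2)
    (h : IsOrbitGraph γ T F y) (hpos : ∀ x, 0 < y x) :
    LipschitzWith (c + 2 * γ).toNNReal y := by
  refine lipschitzWith_of_nnnorm_deriv_le
    (fun x => (h.hasDerivAt (hpos x)).differentiableAt) fun x => ?_
  rw [← NNReal.coe_le_coe, coe_nnnorm, (h.hasDerivAt (hpos x)).deriv,
    Real.coe_toNNReal _ (by positivity), Real.norm_eq_abs]
  have hratio : |F x / y x| ≤ c + γ := by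
    rw [abs_div, abs_of_pos (hpos x), div_le_iff₀ (hpos x)]
    exact h.abs_force_le hγ hc hT hFp hF hF' hpos x
  linarith [abs_sub (F x / y x) γ, abs_of_pos hγ]

end IsOrbitGraph

/-- The speed `√(2 q)` of a particle with kinetic energy `q`, cut off to the interval `[a, b]`.
For `0 < a` it is a bounded Lipschitz function of `q`. -/
noncomputable def clampedSpeed (a b q : ℝ) : ℝ := √(2 * max (a ^ 2 / 2) (min q (b ^ 2 / 2)))

section clampedSpeed

variable {a b q w : ℝ}

theorem clampedSpeed_sq_div_two :
    clampedSpeed a b q ^ 2 / 2 = max (a ^ 2 / 2) (min q (b ^ 2 / 2)) := by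
  rw [clampedSpeed, Real.sq_sqrt, mul_div_cancel_left₀ _ two_ne_zero]
  exact mul_nonneg zero_le_two (le_max_of_le_left (by positivity))

theorem le_clampedSpeed : a ≤ clampedSpeed a b q :=
  Real.le_sqrt_of_sq_le (by linarith [le_max_left (a ^ 2 / 2) (min q (b ^ 2 / 2))])

theorem clampedSpeed_le (ha : 0 ≤ a) (hab : a ≤ b) : clampedSpeed a b q ≤ b := by
  refine Real.sqrt_le_iff.2 ⟨ha.trans hab, ?_⟩
  have := max_le (by gcongr) (min_le_right q (b ^ 2 / 2)) (a := a ^ 2 / 2)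
  linarith

theorem clampedSpeed_of_le (ha : 0 ≤ a) (hq : q ≤ a ^ 2 / 2) : clampedSpeed a b q = a := by
  rw [clampedSpeed, max_eq_left ((min_le_left _ _).trans hq), mul_div_cancel₀ _ two_ne_zero,
    Real.sqrt_sq ha]

theorem clampedSpeed_of_ge (ha : 0 ≤ a) (hab : a ≤ b) (hq : b ^ 2 / 2 ≤ q) :
    clampedSpeed a b q = b := by
  rw [clampedSpeed, min_eq_right hq, max_eq_right (by gcongr), mul_div_cancel₀ _ two_ne_zero,
    Real.sqrt_sq (ha.trans hab)]

theorem sq_div_two_le_of_le_clampedSpeed (ha : 0 ≤ a) (haw : a < w)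
    (hw : w ≤ clampedSpeed a b q) : w ^ 2 / 2 ≤ q := by
  have hsq : w ^ 2 / 2 ≤ max (a ^ 2 / 2) (min q (b ^ 2 / 2)) := by
    rw [← clampedSpeed_sq_div_two]
    have := ha.trans haw.le
    gcongr
  have hlt : a ^ 2 / 2 < w ^ 2 / 2 := by gcongr
  exact ((le_max_iff.1 hsq).resolve_left hlt.not_ge).trans (min_le_left _ _)

theorem lipschitzWith_clampedSpeed (ha : 0 < a) :
    LipschitzWith a⁻¹.toNNReal (clampedSpeed a b) := by
  refine LipschitzWith.of_dist_le_mul fun p q => ?_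
  have hsq : |clampedSpeed a b p ^ 2 / 2 - clampedSpeed a b q ^ 2 / 2| ≤ |p - q| := by
    rw [clampedSpeed_sq_div_two, clampedSpeed_sq_div_two]
    refine (abs_max_sub_max_le_max _ _ _ _).trans (max_le (by simp) ?_)
    exact (abs_min_sub_min_le_max _ _ _ _).trans (by simp)
  have hsum : a ≤ (clampedSpeed a b p + clampedSpeed a b q) / 2 := by
    linarith [le_clampedSpeed (a := a) (b := b) (q := p),
      le_clampedSpeed (a := a) (b := b) (q := q)]
  rw [Real.coe_toNNReal _ (inv_nonneg.2 ha.le), inv_mul_eq_div, le_div_iff₀ ha, Real.dist_eq,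
    Real.dist_eq]
  calc |clampedSpeed a b p - clampedSpeed a b q| * a
      ≤ |clampedSpeed a b p - clampedSpeed a b q| *
          |(clampedSpeed a b p + clampedSpeed a b q) / 2| := by gcongr; exact le_abs.2 (.inl hsum)
    _ = |clampedSpeed a b p ^ 2 / 2 - clampedSpeed a b q ^ 2 / 2| := by
        rw [← abs_mul]; congr 1; ring
    _ ≤ |p - q| := hsq

end clampedSpeed

section clampedEquation

variable {γ T a b : ℝ} {F G w q : ℝ → ℝ}

theorem sub_eq_integral_of_clampedSpeed_eq {c : ℝ} (hT : 0 ≤ T) (hF : Continuous F)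
    (hq : ∀ x, HasDerivAt q (F x - γ * clampedSpeed a b (q x)) x)
    (hc : ∀ x ∈ Set.Icc 0 T, clampedSpeed a b (q x) = c) :
    q T - q 0 = (∫ x in 0..T, F x) - γ * c * T := by
  have hint := hF.intervalIntegrable (μ := MeasureTheory.volume) 0 T
  rw [← intervalIntegral.integral_eq_sub_of_hasDerivAt (f' := fun x => F x - γ * c)
    (fun x hx => ?_) (hint.sub intervalIntegrable_const),
    intervalIntegral.integral_sub hint intervalIntegrable_const]
  · rw [intervalIntegral.integral_const, sub_zero, smul_eq_mul, mul_comm T]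
  · rw [← hc x (by rwa [Set.uIcc_of_le hT] at hx)]
    exact hq x

theorem exists_periodic_clamped (hγ : 0 ≤ γ) (hT : 0 < T) (ha : 0 < a) (hab : a ≤ b)
    (hF : Continuous F) (hFp : Function.Periodic F T) (hlow : γ * a * T ≤ ∫ x in 0..T, F x)
    (hhigh : ∫ x in 0..T, F x ≤ γ * b * T) :
    ∃ q, Function.Periodic q T ∧ ∀ x, HasDerivAt q (F x - γ * clampedSpeed a b (q x)) x := by
  obtain ⟨m, hm⟩ := exists_forall_ge_of_periodic (f := fun x => |F x|)
    (fun x => by simp only [hFp x]) hT.ne' hF.abs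
  have hbound : ∀ x q, |F x - γ * clampedSpeed a b q| ≤ |F m| + γ * b := fun x q => by
    refine (abs_sub _ _).trans (add_le_add (hm x) ?_)
    rw [abs_of_nonneg (mul_nonneg hγ (ha.le.trans le_clampedSpeed))]
    exact mul_le_mul_of_nonneg_left (clampedSpeed_le ha.le hab) hγ
  refine exists_periodic_solution (M := (|F m| + γ * b).toNNReal) (r := a ^ 2 / 2)
    (R := b ^ 2 / 2) hT.le
    (fun x => (LipschitzWith.const (F x)).sub
      ((lipschitzWith_smul γ).comp (lipschitzWith_clampedSpeed ha)))
    (fun q => hF.sub continuous_const) (fun x q => (hbound x q).trans (Real.le_coe_toNNReal _))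
    (fun x => by simp only [hFp x]) (fun q hq hr => ?_) fun q hq hR => ?_
  · linarith [sub_eq_integral_of_clampedSpeed_eq hT.le hF hq fun x hx =>
      clampedSpeed_of_le ha.le (hr x hx)]
  · linarith [sub_eq_integral_of_clampedSpeed_eq hT.le hF hq fun x hx =>
      clampedSpeed_of_ge ha.le hab (hR x hx)]

theorem IsOrbitGraph.sq_div_two_le_of_clamped (hγ : 0 < γ) (hT : T ≠ 0) (ha : 0 ≤ a)
    (hw : IsOrbitGraph γ T G w) (haw : ∀ x, a < w x) (hGF : ∀ x, G x ≤ F x)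
    (hqp : Function.Periodic q T) (hq : ∀ x, HasDerivAt q (F x - γ * clampedSpeed a b (q x)) x)
    (x : ℝ) : w x ^ 2 / 2 ≤ q x := by
  obtain ⟨m, hmin, hm⟩ := exists_forall_le_and_deriv_eq_zero_of_periodic
    (f := fun x => q x - w x ^ 2 / 2) (fun x => by simp only [hqp x, hw.periodic x]) hT
    fun x => (hq x).sub (hw.deriv_sq x)
  have hwm : w m ≤ clampedSpeed a b (q m) := le_of_mul_le_mul_left (by linarith [hGF m]) hγ
  linarith [hmin x, sq_div_two_le_of_le_clampedSpeed ha (haw m) hwm]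

theorem le_sq_div_two_of_clamped (hT : T ≠ 0) (ha : 0 ≤ a) (hab : a ≤ b)
    (hFb : ∀ x, F x < γ * b) (hqp : Function.Periodic q T)
    (hq : ∀ x, HasDerivAt q (F x - γ * clampedSpeed a b (q x)) x) (x : ℝ) : q x ≤ b ^ 2 / 2 := by
  obtain ⟨m, hmax, hm⟩ := exists_forall_ge_and_deriv_eq_zero_of_periodic hqp hT hq
  by_contra! hlt
  rw [clampedSpeed_of_ge ha hab (hlt.trans_le (hmax x)).le] at hm
  linarith [hFb m]

theorem IsOrbitGraph.of_clamped (hqp : Function.Periodic q T)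
    (hq : ∀ x, HasDerivAt q (F x - γ * clampedSpeed a b (q x)) x)
    (hqa : ∀ x, a ^ 2 / 2 ≤ q x) (hqb : ∀ x, q x ≤ b ^ 2 / 2) :
    IsOrbitGraph γ T F fun x => clampedSpeed a b (q x) where
  nonneg _ := Real.sqrt_nonneg _
  periodic x := by simp only [hqp x]
  deriv_sq x := by
    simp only [clampedSpeed_sq_div_two, min_eq_left (hqb _), max_eq_right (hqa _)]
    exact hq x

theorem IsOrbitGraph.exists_pos_of_force_le (hγ : 0 < γ) (hT : 0 < T) (hG : Continuous G)
    (hw : IsOrbitGraph γ T G w) (hpos : ∀ x, 0 < w x) (hF : Continuous F)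
    (hFp : Function.Periodic F T) (hGF : ∀ x, G x ≤ F x) :
    ∃ y, IsOrbitGraph γ T F y ∧ ∀ x, 0 < y x := by
  obtain ⟨m, hm⟩ := exists_forall_le_of_periodic hw.periodic hT.ne' hw.continuous
  obtain ⟨M, hM⟩ := exists_forall_ge_of_periodic hFp hT.ne' hF
  obtain ⟨a, ha, ham⟩ := exists_between (hpos m)
  obtain ⟨b, hb⟩ := exists_gt (max a (F M / γ))
  obtain ⟨hab, hFb⟩ := max_lt_iff.1 hb
  replace hFb : ∀ x, F x < γ * b := fun x => (hM x).trans_lt ((div_lt_iff₀' hγ).1 hFb)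
  have haw : ∀ x, a < w x := fun x => ham.trans_le (hm x)
  have hintegral : ∀ {f g : ℝ → ℝ}, Continuous f → Continuous g → (∀ x, f x ≤ g x) →
      ∫ x in 0..T, f x ≤ ∫ x in 0..T, g x := fun hf hg hle =>
    intervalIntegral.integral_mono hT.le (hf.intervalIntegrable _ _) (hg.intervalIntegrable _ _) hle
  have hlow : γ * a * T ≤ ∫ x in 0..T, F x := by
    have := hintegral continuous_const hw.continuous fun x => (haw x).le
    calc γ * a * T = γ * ∫ _ in 0..T, a := by simp; ring
      _ ≤ γ * ∫ x in 0..T, w x := by gcongr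
      _ = ∫ x in 0..T, G x := (hw.integral_force hG).symm
      _ ≤ ∫ x in 0..T, F x := hintegral hG hF hGF
  have hhigh : ∫ x in 0..T, F x ≤ γ * b * T := by
    refine (hintegral hF continuous_const fun x => (hFb x).le).trans_eq ?_
    rw [intervalIntegral.integral_const, sub_zero, smul_eq_mul, mul_comm]
  obtain ⟨q, hqp, hq⟩ := exists_periodic_clamped hγ.le hT ha hab.le hF hFp hlow hhigh
  refine ⟨_, .of_clamped hqp hq (fun x => ?_)
    (le_sq_div_two_of_clamped hT.ne' ha.le hab.le hFb hqp hq), fun x => ha.trans_le le_clampedSpeed⟩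
  have := haw x
  exact le_trans (by gcongr) (hw.sq_div_two_le_of_clamped hγ hT.ne' ha.le haw hGF hqp hq x)

end clampedEquation

section limitGraph

variable {ι : Type*} {l : Filter ι} {γ T β : ℝ} {F f y : ℝ → ℝ}

theorem IsOrbitGraph.of_tendstoLocallyUniformly [l.NeBot] {G Y : ι → ℝ → ℝ}
    (hY : ∀ n, IsOrbitGraph γ T (G n) (Y n)) (hG : TendstoLocallyUniformly G F l)
    (hlim : TendstoLocallyUniformly Y y l) : IsOrbitGraph γ T F y := by
  have hat : ∀ x, Tendsto (fun n => Y n x) l (𝓝 (y x)) := fun x =>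
    (tendstoLocallyUniformlyOn_univ.2 hlim).tendsto_at (Set.mem_univ x)
  refine ⟨fun x => ge_of_tendsto' (hat x) fun n => (hY n).nonneg x, fun x => tendsto_nhds_unique
    (hat (x + T)) ((hat x).congr fun n => ((hY n).periodic x).symm), fun x => ?_⟩
  have hderiv : TendstoLocallyUniformly (fun n x => G n x - γ * Y n x)
      (fun x => F x - γ * y x) l :=
    hG.sub ((lipschitzWith_smul γ).uniformContinuous.comp_tendstoLocallyUniformly hlim)
  exact hasDerivAt_of_tendstoLocallyUniformlyOn isOpen_univ
    (tendstoLocallyUniformlyOn_univ.2 hderiv) (Eventually.of_forall fun n x _ => (hY n).deriv_sq x)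
    (fun x _ => ((hat x).pow 2).div_const 2) (Set.mem_univ x)

theorem IsOrbitGraph.exists_limit_of_antitone {K : NNReal} {b : ℕ → ℝ} {Y : ℕ → ℝ → ℝ}
    (hγ : 0 < γ) (hT : T ≠ 0) (hb : Antitone b) (hlim : Tendsto b atTop (𝓝 β))
    (hY : ∀ n, IsOrbitGraph γ T (fun x => b n - f x) (Y n)) (hK : ∀ n, LipschitzWith K (Y n)) :
    ∃ y, IsOrbitGraph γ T (fun x => β - f x) y ∧ LipschitzWith K y := by
  have hanti : Antitone Y := fun m n hmn x =>
    (hY n).le_of_force_le hγ hT (hY m) (fun x => sub_le_sub_right (hb hmn) _) x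
  have hYlim : ∀ x, Tendsto (fun n => Y n x) atTop (𝓝 (⨅ n, Y n x)) := fun x =>
    tendsto_atTop_ciInf (fun m n hmn => hanti hmn x) ⟨0, Set.forall_mem_range.2 fun n =>
      (hY n).nonneg x⟩
  have hLip : LipschitzWith K fun x => ⨅ n, Y n x := LipschitzWith.of_dist_le_mul fun p q =>
    le_of_tendsto' ((hYlim p).dist (hYlim q)) fun n => (hK n).dist_le_mul p q
  refine ⟨_, .of_tendstoLocallyUniformly hY ?_ (Antitone.tendstoLocallyUniformly_of_forall_tendsto
    (fun n => (hY n).continuous) hanti hLip.continuous hYlim), hLip⟩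
  refine (Metric.tendstoUniformly_iff.2 fun ε hε => ?_).tendstoLocallyUniformly
  filter_upwards [Metric.tendsto_nhds.1 hlim ε hε] with n hn x
  rwa [dist_sub_right, dist_comm]

end limitGraph

/-- The constants `β` for which the damped motion in the force field `β - f` has a positive
`T`-periodic orbit graph. -/
def runningDrives (γ T : ℝ) (f : ℝ → ℝ) : Set ℝ :=
  {β | ∃ y, IsOrbitGraph γ T (fun x => β - f x) y ∧ ∀ x, 0 < y x}

/-- The infimum of the drives with a positive periodic orbit graph. For `0 < γ` and continuous
`T`-periodic `f` the set is nonempty and bounded below. -/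
noncomputable def criticalDrive (γ T : ℝ) (f : ℝ → ℝ) : ℝ := sInf (runningDrives γ T f)

section criticalDrive

variable {γ γ' T β β' : ℝ} {f : ℝ → ℝ}

theorem mem_runningDrives_of_forall_lt (hγ : 0 < γ) (hT : 0 < T) (hf : Continuous f)
    (hfp : Function.Periodic f T) (hβ : ∀ x, f x < β) : β ∈ runningDrives γ T f := by
  obtain ⟨m, hm⟩ := exists_forall_ge_of_periodic hfp hT.ne' hf
  have hconst : IsOrbitGraph γ T (fun _ => β - f m) fun _ => (β - f m) / γ :=
    ⟨fun _ => div_nonneg (sub_nonneg.2 (hβ m).le) hγ.le, fun _ => rfl,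
      fun x => (hasDerivAt_const x _).congr_deriv (by field_simp; ring)⟩
  exact hconst.exists_pos_of_force_le hγ hT continuous_const
    (fun _ => div_pos (sub_pos.2 (hβ m)) hγ) (continuous_const.sub hf)
    (fun x => by simp only [hfp x]) fun x => sub_le_sub_left (hm x) β

theorem mem_runningDrives_of_le (hγ : 0 < γ) (hT : 0 < T) (hf : Continuous f)
    (hfp : Function.Periodic f T) (hγγ' : γ ≤ γ') (hβ : β ≤ β') (h : β ∈ runningDrives γ' T f) :
    β' ∈ runningDrives γ T f := by
  obtain ⟨y, hy, hpos⟩ := h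
  refine (hy.change_damping (γ' := γ)).exists_pos_of_force_le hγ hT
    (by have := hy.continuous; fun_prop) hpos (continuous_const.sub hf)
    (fun x => by simp only [hfp x]) fun x => ?_
  have := mul_le_mul_of_nonneg_right hγγ' (hpos x).le
  linarith

theorem IsOrbitGraph.sqrt_sq_sub {F y : ℝ → ℝ} {c : ℝ} (h : IsOrbitGraph γ T F y)
    (hc : ∀ x, c ≤ y x ^ 2) :
    IsOrbitGraph γ T (fun x => F x - γ * (y x - √(y x ^ 2 - c))) fun x => √(y x ^ 2 - c) where
  nonneg _ := Real.sqrt_nonneg _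
  periodic x := by simp only [h.periodic x]
  deriv_sq x := by
    simp only [Real.sq_sqrt (sub_nonneg.2 (hc _)), sub_div]
    exact ((h.deriv_sq x).sub_const (c / 2)).congr_deriv (by ring)

theorem exists_mem_runningDrives_lt (hγ : 0 < γ) (hT : 0 < T) (hf : Continuous f)
    (hfp : Function.Periodic f T) (h : β ∈ runningDrives γ T f) :
    ∃ β' ∈ runningDrives γ T f, β' < β := by
  obtain ⟨y, hy, hpos⟩ := h
  have hcont := hy.continuous
  obtain ⟨m, hm⟩ := exists_forall_le_of_periodic hy.periodic hT.ne' hcont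
  have hm₀ : 0 < y m ^ 2 / 2 := by have := hpos m; positivity
  have hc : ∀ x, y m ^ 2 / 2 < y x ^ 2 := fun x => by
    linarith [pow_le_pow_left₀ (hpos m).le (hm x) 2]
  have hw := hy.sqrt_sq_sub fun x => (hc x).le
  obtain ⟨p, hp⟩ := exists_forall_le_of_periodic
    (f := fun x => y x - √(y x ^ 2 - y m ^ 2 / 2)) (fun x => by simp only [hy.periodic x]) hT.ne'
    (by fun_prop)
  have hgap : √(y p ^ 2 - y m ^ 2 / 2) < y p := (Real.sqrt_lt' (hpos p)).2 (by linarith)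
  refine ⟨β - γ * (y p - √(y p ^ 2 - y m ^ 2 / 2)), ?_,
    sub_lt_self _ (mul_pos hγ (sub_pos.2 hgap))⟩
  refine hw.exists_pos_of_force_le hγ hT (by fun_prop) (fun x => Real.sqrt_pos.2 (sub_pos.2 (hc x)))
    (continuous_const.sub hf) (fun x => by simp only [hfp x]) fun x => ?_
  linarith [mul_le_mul_of_nonneg_left (hp x) hγ.le]

theorem bddBelow_runningDrives (hγ : 0 ≤ γ) (hT : 0 < T) (hf : Continuous f) :
    BddBelow (runningDrives γ T f) := by
  refine ⟨(∫ x in 0..T, f x) / T, fun β ⟨y, hy, _⟩ => ?_⟩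
  have hint : ∫ x in 0..T, (β - f x) = γ * ∫ x in 0..T, y x :=
    hy.integral_force (continuous_const.sub hf)
  rw [intervalIntegral.integral_sub intervalIntegrable_const (hf.intervalIntegrable _ _),
    intervalIntegral.integral_const, sub_zero, smul_eq_mul] at hint
  have := mul_nonneg hγ (intervalIntegral.integral_nonneg (μ := MeasureTheory.volume) hT.le
    fun x _ => hy.nonneg x)
  exact (div_le_iff₀' hT).2 (by linarith)

theorem nonempty_runningDrives (hγ : 0 < γ) (hT : 0 < T) (hf : Continuous f)
    (hfp : Function.Periodic f T) : (runningDrives γ T f).Nonempty :=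
  let ⟨m, hm⟩ := exists_forall_ge_of_periodic hfp hT.ne' hf
  ⟨f m + 1, mem_runningDrives_of_forall_lt hγ hT hf hfp fun x => (hm x).trans_lt (lt_add_one _)⟩

theorem mem_runningDrives_iff (hγ : 0 < γ) (hT : 0 < T) (hf : Continuous f)
    (hfp : Function.Periodic f T) : β ∈ runningDrives γ T f ↔ criticalDrive γ T f < β := by
  constructor
  · intro h
    obtain ⟨β', hβ', hlt⟩ := exists_mem_runningDrives_lt hγ hT hf hfp h
    exact (csInf_le (bddBelow_runningDrives hγ.le hT hf) hβ').trans_lt hlt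
  · intro h
    obtain ⟨β', hβ', hlt⟩ := exists_lt_of_csInf_lt (nonempty_runningDrives hγ hT hf hfp) h
    exact mem_runningDrives_of_le hγ hT hf hfp le_rfl hlt.le hβ'

theorem criticalDrive_le_of_forall_le (hγ : 0 < γ) (hT : 0 < T) (hf : Continuous f)
    (hfp : Function.Periodic f T) (hβ : ∀ x, f x ≤ β) : criticalDrive γ T f ≤ β :=
  le_of_forall_gt fun _ hlt => (mem_runningDrives_iff hγ hT hf hfp).1
    (mem_runningDrives_of_forall_lt hγ hT hf hfp fun x => (hβ x).trans_lt hlt)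

theorem criticalDrive_mono (hγ : 0 < γ) (hT : 0 < T) (hf : Continuous f)
    (hfp : Function.Periodic f T) (h : γ ≤ γ') : criticalDrive γ T f ≤ criticalDrive γ' T f :=
  csInf_le_csInf (bddBelow_runningDrives hγ.le hT hf)
    (nonempty_runningDrives (hγ.trans_le h) hT hf hfp)
    fun _ hβ => mem_runningDrives_of_le hγ hT hf hfp h le_rfl hβ

theorem exists_critical_graph {c : ℝ} {f' : ℝ → ℝ} (hγ : 0 < γ) (hT : 0 < T) (hc : 0 ≤ c)
    (hfp : Function.Periodic f T) (hf : ∀ x, HasDerivAt f (f' x) x) (hf' : ∀ x, |f' x| ≤ c ^ 2) :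
    ∃ y, IsOrbitGraph γ T (fun x => criticalDrive γ T f - f x) y ∧
      LipschitzWith (c + 2 * γ).toNNReal y ∧ ∃ x, y x = 0 := by
  have hmem {β} := mem_runningDrives_iff (β := β) hγ hT (continuous_of_forall_hasDerivAt hf) hfp
  obtain ⟨b, hb, hb_gt, hblim⟩ := exists_seq_strictAnti_tendsto (criticalDrive γ T f)
  choose Y hY hYpos using fun n => hmem.2 (hb_gt n)
  obtain ⟨y, hy, hLip⟩ := IsOrbitGraph.exists_limit_of_antitone hγ hT.ne' hb.antitone hblim hY
    fun n => (hY n).lipschitzWith hγ hc hT.ne' (fun x => by simp only [hfp x])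
      (fun x => (hf x).const_sub (b n)) (fun x => (abs_neg _).trans_le (hf' x)) (hYpos n)
  refine ⟨y, hy, hLip, ?_⟩
  by_contra! hne
  exact lt_irrefl _ (hmem.1 ⟨y, hy, fun x => (hy.nonneg x).lt_of_ne' (hne x)⟩)

end criticalDrive

/-- The difference between the kinetic energy `y(φ)² / 2` prescribed by an orbit graph `y` at the
current position and the actual one, along the motion `(φ, z)`. Its square is a Lyapunov function
when the motion and the graph belong to the same force. -/
noncomputable def kineticGap (y φ z : ℝ → ℝ) (t : ℝ) : ℝ := y (φ t) ^ 2 / 2 - z t ^ 2 / 2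

theorem tendsto_kineticGap {y φ z : ℝ → ℝ} {l : Filter ℝ} {x v : ℝ} (hy : Continuous y)
    (hφ : Tendsto φ l (𝓝 x)) (hz : Tendsto z l (𝓝 v)) :
    Tendsto (kineticGap y φ z) l (𝓝 (y x ^ 2 / 2 - v ^ 2 / 2)) :=
  ((((hy.tendsto x).comp hφ).pow 2).div_const 2).sub ((hz.pow 2).div_const 2)

theorem kineticGap_add_period {y φ z : ℝ → ℝ} {S T t : ℝ} {n : ℤ} (hy : Function.Periodic y T)
    (hφ : φ (t + S) = φ t + n • T) (hz : z (t + S) = z t) :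
    kineticGap y φ z (t + S) = kineticGap y φ z t := by
  unfold kineticGap
  rw [hφ, hz, hy.zsmul n]

namespace IsDampedMotion

variable {γ T : ℝ} {F G φ z y : ℝ → ℝ}

theorem hasDerivAt_kineticGap (h : IsDampedMotion γ G φ z) (hy : IsOrbitGraph γ T F y) (t : ℝ) :
    HasDerivAt (kineticGap y φ z) (z t * (F (φ t) - G (φ t) - γ * (y (φ t) - z t))) t := by
  refine (((hy.deriv_sq (φ t)).comp t (h.deriv_phi t)).sub
    (((h.deriv_z t).pow 2).div_const 2)).congr_deriv ?_
  norm_num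
  ring

theorem hasDerivAt_kineticGap_sq (h : IsDampedMotion γ F φ z) (hy : IsOrbitGraph γ T F y)
    (t : ℝ) : HasDerivAt (fun t => kineticGap y φ z t ^ 2)
      (-(γ * z t * (y (φ t) + z t) * (y (φ t) - z t) ^ 2)) t := by
  refine ((h.hasDerivAt_kineticGap hy t).pow 2).congr_deriv ?_
  norm_num [kineticGap]
  ring

theorem antitoneOn_kineticGap_sq (hγ : 0 ≤ γ) (h : IsDampedMotion γ F φ z)
    (hy : IsOrbitGraph γ T F y) {s : Set ℝ} (hs : Convex ℝ s) (hz : ∀ t ∈ s, 0 ≤ z t) :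
    AntitoneOn (fun t => kineticGap y φ z t ^ 2) s :=
  antitoneOn_of_hasDerivAt_nonpos hs (h.hasDerivAt_kineticGap_sq hy) fun t ht => by
    have hzt := hz t (interior_subset ht)
    have hyt := hy.nonneg (φ t)
    exact neg_nonpos.2 (by positivity)

theorem velocity_eq_of_kineticGap_sq_le (hγ : 0 < γ) (h : IsDampedMotion γ F φ z)
    (hy : IsOrbitGraph γ T F y) {t : ℝ} (hz : 0 < z t)
    (hmax : ∀ s, kineticGap y φ z s ^ 2 ≤ kineticGap y φ z t ^ 2) : z t = y (φ t) := by
  have hderiv := IsLocalMax.hasDerivAt_eq_zero (Eventually.of_forall hmax)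
    (h.hasDerivAt_kineticGap_sq hy t)
  have hne : γ * z t * (y (φ t) + z t) ≠ 0 :=
    (mul_pos (mul_pos hγ hz) (add_pos_of_nonneg_of_pos (hy.nonneg _) hz)).ne'
  have hsq := (mul_eq_zero.1 (neg_eq_zero.1 hderiv)).resolve_left hne
  exact (sub_eq_zero.1 (pow_eq_zero_iff two_ne_zero |>.1 hsq)).symm

theorem eventually_velocity_eq (hγ : 0 ≤ γ) (h : IsDampedMotion γ F φ z)
    (hy : IsOrbitGraph γ T F y) (hup : ∀ᶠ t in atBot, 0 < z t) {s : ℝ} (hys : y s = 0)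
    (hφ : Tendsto φ atBot (𝓝 s)) (hz : Tendsto z atBot (𝓝 0)) :
    ∀ᶠ t in atBot, z t = y (φ t) := by
  obtain ⟨t₀, ht₀⟩ := eventually_atBot.1 hup
  have hanti := h.antitoneOn_kineticGap_sq hγ hy (convex_Iic t₀) fun t ht => (ht₀ t ht).le
  have hlim : Tendsto (fun t => kineticGap y φ z t ^ 2) atBot (𝓝 0) := by
    simpa [hys] using (tendsto_kineticGap hy.continuous hφ hz).pow 2
  filter_upwards [eventually_le_atBot t₀] with t ht
  have hle : kineticGap y φ z t ^ 2 ≤ 0 := ge_of_tendsto hlim <|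
    (eventually_le_atBot t).mono fun s hs => hanti (hs.trans ht) ht hs
  have hzero : kineticGap y φ z t = 0 :=
    pow_eq_zero_iff two_ne_zero |>.1 (le_antisymm hle (sq_nonneg _))
  unfold kineticGap at hzero
  exact (sq_eq_sq₀ (ht₀ t ht).le (hy.nonneg _)).1 (by linarith)

theorem graph_eq_zero_of_connection (hγ : 0 < γ) (h : IsDampedMotion γ F φ z)
    (hy : IsOrbitGraph γ T F y) (hpos : ∀ t, 0 < z t) {s : ℝ}
    (hφbot : Tendsto φ atBot (𝓝 s)) (hzbot : Tendsto z atBot (𝓝 0))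
    (hφtop : Tendsto φ atTop (𝓝 (s + T))) (hztop : Tendsto z atTop (𝓝 0)) : y s = 0 := by
  have hanti : Antitone fun t => kineticGap y φ z t ^ 2 := antitoneOn_univ.1 <|
    h.antitoneOn_kineticGap_sq hγ.le hy convex_univ fun t _ => (hpos t).le
  have hbot := (tendsto_kineticGap hy.continuous hφbot hzbot).pow 2
  have htop := (tendsto_kineticGap hy.continuous hφtop hztop).pow 2
  rw [hy.periodic s] at htop
  have hgraph : z 0 = y (φ 0) := h.velocity_eq_of_kineticGap_sq_le hγ hy (hpos 0) fun t =>
    (hanti.ge_of_tendsto hbot t).trans (hanti.le_of_tendsto htop 0)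
  have hgap : kineticGap y φ z 0 = 0 := by rw [kineticGap, hgraph, sub_self]
  have hle : (y s ^ 2 / 2 - 0 ^ 2 / 2) ^ 2 ≤ 0 := by
    simpa [hgap] using hanti.le_of_tendsto htop 0
  have := pow_eq_zero_iff two_ne_zero |>.1 (le_antisymm hle (sq_nonneg _))
  simpa using this

theorem velocity_eq_of_periodic (hγ : 0 < γ) (h : IsDampedMotion γ F φ z)
    (hy : IsOrbitGraph γ T F y) (hpos : ∀ t, 0 < z t) {S : ℝ} (hS : 0 < S) {n : ℤ}
    (hφ : ∀ t, φ (t + S) = φ t + n • T) (hz : ∀ t, z (t + S) = z t) (t : ℝ) :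
    z t = y (φ t) := by
  have hanti : Antitone fun t => kineticGap y φ z t ^ 2 := antitoneOn_univ.1 <|
    h.antitoneOn_kineticGap_sq hγ.le hy convex_univ fun t _ => (hpos t).le
  have hp : Function.Periodic (fun t => kineticGap y φ z t ^ 2) S := fun t =>
    congrArg (· ^ 2) (kineticGap_add_period hy.periodic (hφ t) (hz t))
  refine h.velocity_eq_of_kineticGap_sq_le hγ hy (hpos t) fun s => ?_
  obtain ⟨r, hr, hsr⟩ := hp.exists_mem_Ico hS s t
  exact hsr.trans_le (hanti hr.1)

theorem velocity_lt_of_kineticGap_min (hγ : 0 < γ) (hGF : ∀ x, G x < F x)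
    (hy : IsOrbitGraph γ T F y) (hpos : ∀ t, 0 < z t) {m : ℝ}
    (hmin : ∀ t, kineticGap y φ z m ≤ kineticGap y φ z t)
    (hm : z m * (F (φ m) - G (φ m) - γ * (y (φ m) - z m)) = 0) (t : ℝ) : z t < y (φ t) := by
  have hbalance := (mul_eq_zero.1 hm).resolve_left (hpos m).ne'
  have hzy : z m < y (φ m) := lt_of_mul_lt_mul_left (by linarith [hGF (φ m)]) hγ.le
  have hgap := hmin t
  unfold kineticGap at hgap
  refine lt_of_pow_lt_pow_left₀ 2 (hy.nonneg _) ?_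
  linarith [pow_lt_pow_left₀ hzy (hpos m).le two_ne_zero]

theorem velocity_le_of_connection (hγ : 0 < γ) (hGF : ∀ x, G x < F x)
    (h : IsDampedMotion γ G φ z) (hy : IsOrbitGraph γ T F y) (hpos : ∀ t, 0 < z t) {s₀ s₁ : ℝ}
    (hφbot : Tendsto φ atBot (𝓝 s₀)) (hzbot : Tendsto z atBot (𝓝 0))
    (hφtop : Tendsto φ atTop (𝓝 s₁)) (hztop : Tendsto z atTop (𝓝 0)) (t : ℝ) :
    z t ≤ y (φ t) := by
  by_contra! hlt
  have hneg : ∀ c, kineticGap y φ z t < c ^ 2 / 2 - 0 ^ 2 / 2 := fun c => by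
    unfold kineticGap
    linarith [pow_lt_pow_left₀ hlt (hy.nonneg _) two_ne_zero, sq_nonneg c]
  obtain ⟨m, hmin, hm⟩ := exists_forall_le_and_deriv_eq_zero_of_tendsto
    (h.hasDerivAt_kineticGap hy) (tendsto_kineticGap hy.continuous hφbot hzbot)
    (tendsto_kineticGap hy.continuous hφtop hztop) (hneg _) (hneg _)
  exact hlt.not_ge (velocity_lt_of_kineticGap_min hγ hGF hy hpos hmin hm t).le

theorem velocity_lt_of_periodic (hγ : 0 < γ) (hGF : ∀ x, G x < F x)
    (h : IsDampedMotion γ G φ z) (hy : IsOrbitGraph γ T F y) (hpos : ∀ t, 0 < z t) {S : ℝ}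
    (hS : S ≠ 0) {n : ℤ} (hφ : ∀ t, φ (t + S) = φ t + n • T) (hz : ∀ t, z (t + S) = z t)
    (t : ℝ) : z t < y (φ t) := by
  obtain ⟨m, hmin, hm⟩ := exists_forall_le_and_deriv_eq_zero_of_periodic
    (fun t => kineticGap_add_period hy.periodic (hφ t) (hz t)) hS (h.hasDerivAt_kineticGap hy)
  exact velocity_lt_of_kineticGap_min hγ hGF hy hpos hmin hm t

end IsDampedMotion

theorem infDist_graphCurve_le (y : ℝ → ℝ) (a b : ℝ) :
    Metric.infDist (a, b) (graphCurve y) ≤ |b - y a| := by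
  refine (Metric.infDist_le_dist_of_mem (show (a, y a) ∈ graphCurve y from rfl)).trans ?_
  simp [Prod.dist_eq, Real.dist_eq]

theorem abs_sub_le_mul_infDist_graphCurve {y : ℝ → ℝ} {K : NNReal} (hy : LipschitzWith K y)
    (a b : ℝ) : |b - y a| ≤ (1 + K) * Metric.infDist (a, b) (graphCurve y) := by
  rw [← div_le_iff₀' (by positivity), Metric.le_infDist ⟨(a, y a), (rfl : y a = y a)⟩]
  rintro ⟨p, q⟩ (rfl : q = y p)
  have hpa := hy.dist_le_mul p a
  rw [div_le_iff₀' (by positivity), ← Real.dist_eq]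
  calc dist b (y a) ≤ dist b (y p) + dist (y p) (y a) := dist_triangle _ _ _
    _ ≤ dist (a, b) (p, y p) + K * dist (a, b) (p, y p) :=
      add_le_add (le_max_right _ _) <| hpa.trans <|
        mul_le_mul_of_nonneg_left ((dist_comm p a).trans_le (le_max_left _ _)) K.2
    _ = (1 + K) * dist (a, b) (p, y p) := by ring

theorem abs_kineticGap (y φ z : ℝ → ℝ) (t : ℝ) :
    |kineticGap y φ z t| = |z t - y (φ t)| * |y (φ t) + z t| / 2 := by
  have hfactor : y (φ t) ^ 2 / 2 - z t ^ 2 / 2 = (y (φ t) - z t) * (y (φ t) + z t) / 2 := by ring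
  rw [kineticGap, hfactor, abs_div, abs_mul, abs_two, abs_sub_comm]

namespace IsDampedMotion

variable {γ T m M t : ℝ} {F φ z y : ℝ → ℝ}

theorem velocity_pos_of_abs_kineticGap_le (hγ : 0 ≤ γ) (h : IsDampedMotion γ F φ z)
    (hy : IsOrbitGraph γ T F y) (hm : 0 < m) (hmy : ∀ x, m ≤ y x) (hz₀ : 0 < z 0)
    (hgap : |kineticGap y φ z 0| ≤ m ^ 2 / 4) (ht : 0 ≤ t) : 0 < z t := by
  by_contra! hzt
  obtain ⟨s, hs, hzs, hzpos⟩ := exists_first_zero h.continuous_z ht hz₀ hzt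
  have hanti := h.antitoneOn_kineticGap_sq hγ hy (convex_Icc 0 s) fun r hr =>
    hr.2.eq_or_lt.elim (fun hrs => (hrs ▸ hzs).ge) fun hrs => (hzpos r ⟨hr.1, hrs⟩).le
  have hgap_s := sq_le_sq.1 (hanti ⟨le_rfl, hs.1.le⟩ ⟨hs.1.le, le_rfl⟩ hs.1.le)
  have hlarge : m ^ 2 / 2 ≤ |kineticGap y φ z s| := by
    refine le_trans ?_ (le_abs_self _)
    rw [kineticGap, hzs]
    linarith [pow_le_pow_left₀ hm.le (hmy (φ s)) 2]
  linarith [pow_pos hm 2]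

theorem abs_kineticGap_le (hγ : 0 ≤ γ) (h : IsDampedMotion γ F φ z)
    (hy : IsOrbitGraph γ T F y) (hz : ∀ t, 0 ≤ t → 0 < z t) (ht : 0 ≤ t) :
    |kineticGap y φ z t| ≤ |kineticGap y φ z 0| :=
  sq_le_sq.1 <| h.antitoneOn_kineticGap_sq hγ hy (convex_Ici 0) (fun s hs => (hz s hs).le)
    Set.self_mem_Ici ht ht

theorem velocity_mem_Icc_of_abs_kineticGap_le (hm : 0 < m) (hmy : m ≤ y (φ t)) (hyM : y (φ t) ≤ M)
    (hz : 0 < z t) (hgap : |kineticGap y φ z t| ≤ m ^ 2 / 4) : z t ∈ Set.Icc (m / 2) (2 * M) := by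
  obtain ⟨hlower, hupper⟩ := abs_le.1 hgap
  unfold kineticGap at hlower hupper
  have hmy_sq := pow_le_pow_left₀ hm.le hmy 2
  have hyM_sq := pow_le_pow_left₀ (hm.le.trans hmy) hyM 2
  exact ⟨le_of_sq_le_sq (by nlinarith) hz.le, le_of_sq_le_sq (by nlinarith) (by linarith)⟩

theorem kineticGap_sq_le_mul_exp (hγ : 0 < γ) (h : IsDampedMotion γ F φ z)
    (hy : IsOrbitGraph γ T F y) (hm : 0 < m) (hmy : ∀ x, m ≤ y x) (hyM : ∀ x, y x ≤ M)
    (hz : ∀ t, 0 ≤ t → z t ∈ Set.Icc (m / 2) (2 * M)) (ht : 0 ≤ t) :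
    kineticGap y φ z t ^ 2 ≤
      kineticGap y φ z 0 ^ 2 * Real.exp (-(2 * γ * m / (3 * M)) * t) := by
  have hM : 0 < M := hm.trans_le ((hmy 0).trans (hyM 0))
  refine le_mul_exp_of_deriv_le (h.hasDerivAt_kineticGap_sq hy) (fun s hs => ?_) ht
  obtain ⟨hzm, hzM⟩ := hz s hs
  have hyz : 0 ≤ y (φ s) + z s := by linarith [hmy (φ s)]
  have hrate : 2 * γ * m / (3 * M) * (y (φ s) + z s) ≤ 4 * (γ * z s) :=
    calc 2 * γ * m / (3 * M) * (y (φ s) + z s) ≤ 2 * γ * m / (3 * M) * (3 * M) := by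
          gcongr
          linarith [hyM (φ s)]
      _ = 4 * (γ * (m / 2)) := by field_simp; norm_num
      _ ≤ 4 * (γ * z s) := by gcongr
  have := mul_le_mul_of_nonneg_right hrate (mul_nonneg hyz (sq_nonneg (y (φ s) - z s)))
  unfold kineticGap
  linear_combination this / 4

theorem abs_velocity_sub_le_exp (hγ : 0 < γ) (h : IsDampedMotion γ F φ z)
    (hy : IsOrbitGraph γ T F y) (hm : 0 < m) (hmy : ∀ x, m ≤ y x) (hyM : ∀ x, y x ≤ M)
    (h₀ : |z 0 - y (φ 0)| ≤ m ^ 2 / (6 * M)) (ht : 0 ≤ t) :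
    |z t - y (φ t)| ≤ 3 * M / m * |z 0 - y (φ 0)| * Real.exp (-(γ * m / (3 * M)) * t) := by
  have hmM : m ≤ M := (hmy 0).trans (hyM 0)
  have hM : 0 < M := hm.trans_le hmM
  rw [le_div_iff₀ (by positivity)] at h₀
  obtain ⟨hlower, hupper⟩ := abs_le.1 (show |z 0 - y (φ 0)| ≤ m / 2 by nlinarith)
  have hz₀ : 0 < z 0 := by linarith [hmy (φ 0)]
  have hgap₀ : |kineticGap y φ z 0| ≤ 3 * M / 2 * |z 0 - y (φ 0)| := by
    rw [abs_kineticGap, abs_of_pos (add_pos (hm.trans_le (hmy (φ 0))) hz₀)]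
    nlinarith [abs_nonneg (z 0 - y (φ 0)), hyM (φ 0)]
  have hsmall : |kineticGap y φ z 0| ≤ m ^ 2 / 4 := by linarith
  have hpos : ∀ s, 0 ≤ s → 0 < z s := fun s hs =>
    h.velocity_pos_of_abs_kineticGap_le hγ.le hy hm hmy hz₀ hsmall hs
  have hsq := h.kineticGap_sq_le_mul_exp hγ hy hm hmy hyM (fun s hs =>
    velocity_mem_Icc_of_abs_kineticGap_le hm (hmy _) (hyM _) (hpos s hs)
      ((h.abs_kineticGap_le hγ.le hy hpos hs).trans hsmall)) ht
  have hgap : |kineticGap y φ z t| ≤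
      |kineticGap y φ z 0| * Real.exp (-(γ * m / (3 * M)) * t) := by
    refine abs_le_of_sq_le_sq (hsq.trans_eq ?_) (by positivity)
    rw [mul_pow, sq_abs, ← Real.exp_nat_mul]
    congr 2
    ring
  have hdist : |z t - y (φ t)| * m / 2 ≤ |kineticGap y φ z t| := by
    rw [abs_kineticGap]
    gcongr
    exact (hmy _).trans ((le_add_of_nonneg_right (hpos t ht).le).trans (le_abs_self _))
  have hchain := (hdist.trans hgap).trans
    (mul_le_mul_of_nonneg_right hgap₀ (Real.exp_pos _).le)
  rw [div_mul_eq_mul_div, div_mul_eq_mul_div, le_div_iff₀ hm]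
  linarith

end IsDampedMotion

theorem IsOrbitGraph.exists_infDist_le_exp {γ T : ℝ} {F y : ℝ → ℝ} {K : NNReal} (hγ : 0 < γ)
    (hT : T ≠ 0) (hy : IsOrbitGraph γ T F y) (hLip : LipschitzWith K y) (hpos : ∀ x, 0 < y x) :
    ∃ δ > 0, ∃ C > 0, ∃ c > 0, ∀ φ z : ℝ → ℝ, IsDampedMotion γ F φ z →
      Metric.infDist (φ 0, z 0) (graphCurve y) < δ → ∀ t, 0 ≤ t →
        Metric.infDist (φ t, z t) (graphCurve y) ≤
          C * Metric.infDist (φ 0, z 0) (graphCurve y) * Real.exp (-c * t) := by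
  obtain ⟨a, ha⟩ := exists_forall_le_of_periodic hy.periodic hT hy.continuous
  obtain ⟨b, hb⟩ := exists_forall_ge_of_periodic hy.periodic hT hy.continuous
  have hm := hpos a
  have hM := hpos b
  refine ⟨y a ^ 2 / (6 * y b) / (1 + K), by positivity, 3 * y b / y a * (1 + K), by positivity,
    γ * y a / (3 * y b), by positivity, fun φ z h hδ t ht => ?_⟩
  have hstart := abs_sub_le_mul_infDist_graphCurve hLip (φ 0) (z 0)
  rw [lt_div_iff₀' (by positivity)] at hδ
  refine (infDist_graphCurve_le y _ _).trans
    ((h.abs_velocity_sub_le_exp hγ hy hm ha hb (hstart.trans hδ.le) ht).trans ?_)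
  rw [mul_assoc (3 * y b / y a) (1 + (K : ℝ))]
  gcongr

theorem eventually_lt_of_tendsto_atBot {f f' : ℝ → ℝ} {s : ℝ} (hf : ∀ t, HasDerivAt f (f' t) t)
    (hpos : ∀ᶠ t in atBot, 0 < f' t) (hs : Tendsto f atBot (𝓝 s)) : ∀ᶠ t in atBot, s < f t := by
  obtain ⟨t₀, ht₀⟩ := eventually_atBot.1 hpos
  have hmono : StrictMonoOn f (Set.Iic t₀) :=
    strictMonoOn_of_hasDerivWithinAt_pos (convex_Iic t₀)
      (continuous_of_forall_hasDerivAt hf).continuousOn (fun t _ => (hf t).hasDerivWithinAt)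
      fun t ht =>
        ht₀ t (interior_subset (s := Set.Iic t₀) ht)
  filter_upwards [eventually_le_atBot t₀] with t ht
  have hpred : t - 1 ≤ t₀ := (sub_one_lt t).le.trans ht
  refine lt_of_le_of_lt (le_of_tendsto hs ?_) (hmono hpred ht (sub_one_lt t))
  exact (eventually_le_atBot (t - 1)).mono fun r hr => hmono.monotoneOn (hr.trans hpred) hpred hr

namespace IsOrbitGraph

variable {γ T s₀ s₁ : ℝ} {F y φ z : ℝ → ℝ} {K L : NNReal}

theorem isDampedMotion (hy : IsOrbitGraph γ T F y) (hφ : ∀ t, HasDerivAt φ (y (φ t)) t)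
    (hpos : ∀ t, 0 < y (φ t)) : IsDampedMotion γ F φ fun t => y (φ t) where
  deriv_phi := hφ
  deriv_z t := by
    refine ((hy.hasDerivAt (hpos t)).comp t (hφ t)).congr_deriv ?_
    rw [sub_mul, div_mul_cancel₀ _ (hpos t).ne']

theorem exists_connection (hT : T ≠ 0) (hy : IsOrbitGraph γ T F y) (hLip : LipschitzWith K y)
    (h₀ : y s₀ = 0) (h₁ : y s₁ = 0) (hpos : ∀ x ∈ Set.Ioo s₀ s₁, 0 < y x) {x₀ : ℝ}
    (hx₀ : x₀ ∈ Set.Ioo s₀ s₁) :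
    ∃ φ : ℝ → ℝ, φ 0 = x₀ ∧ (∀ t, φ t ∈ Set.Ioo s₀ s₁) ∧
      IsDampedMotion γ F φ (fun t => y (φ t)) ∧
      Tendsto φ atBot (𝓝 s₀) ∧ Tendsto φ atTop (𝓝 s₁) := by
  obtain ⟨m, hm⟩ := exists_forall_ge_of_periodic hy.periodic hT hy.continuous
  obtain ⟨φ, hφ₀, hφ, hmem, hbot, htop⟩ :=
    exists_flow_between_zeros (M := ⟨y m, hy.nonneg m⟩) hLip
      (fun x => (abs_of_nonneg (hy.nonneg x)).trans_le (hm x)) h₀ h₁ hpos hx₀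
  exact ⟨φ, hφ₀, hmem, hy.isDampedMotion hφ fun t => hpos _ (hmem t), hbot, htop⟩

theorem velocity_pos_and_tendsto_of_departing (hγ : 0 ≤ γ) (hT : T ≠ 0) (hF : LipschitzWith L F)
    (hy : IsOrbitGraph γ T F y) (hLip : LipschitzWith K y) (h₀₁ : s₀ < s₁)
    (h₀ : y s₀ = 0) (h₁ : y s₁ = 0)
    (hpos : ∀ x ∈ Set.Ioo s₀ s₁, 0 < y x) (h : IsDampedMotion γ F φ z)
    (hup : ∀ᶠ t in atBot, 0 < z t) (hφ : Tendsto φ atBot (𝓝 s₀)) (hz : Tendsto z atBot (𝓝 0)) :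
    (∀ t, 0 < z t) ∧ Tendsto φ atTop (𝓝 s₁) ∧ Tendsto z atTop (𝓝 0) := by
  obtain ⟨t₀, hzt₀, hlow, hhigh⟩ := ((h.eventually_velocity_eq hγ hy hup h₀ hφ hz).and
    ((eventually_lt_of_tendsto_atBot h.deriv_phi hup hφ).and (hφ.eventually_lt_const h₀₁))).exists
  obtain ⟨ψ, hψ₀, hmem, hψ, -, htop⟩ := hy.exists_connection hT hLip h₀ h₁ hpos ⟨hlow, hhigh⟩
  obtain ⟨rfl, rfl⟩ := h.unique hF (hψ.comp_add_const (-t₀)) (t₀ := t₀) (by simp [hψ₀])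
    (by simp [hψ₀, hzt₀])
  have htop' : Tendsto (fun t => ψ (t + -t₀)) atTop (𝓝 s₁) :=
    htop.comp (tendsto_atTop_add_const_right _ _ tendsto_id)
  exact ⟨fun t => hpos _ (hmem _), htop', h₁ ▸ (hy.continuous.tendsto s₁).comp htop'⟩

theorem force_eq_zero_of_eq_zero (hy : IsOrbitGraph γ T F y) {x : ℝ} (hx : y x = 0) :
    F x = 0 := by
  have hmin : IsLocalMin (fun x => y x ^ 2 / 2) x :=
    Eventually.of_forall fun r => by
      simp only [hx]
      gcongr
      exact hy.nonneg r
  simpa [hx] using hmin.hasDerivAt_eq_zero (hy.deriv_sq x)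

theorem deriv_force_nonneg_of_eq_zero (hγ : 0 ≤ γ) (hy : IsOrbitGraph γ T F y) {x F' : ℝ}
    (hx : y x = 0) (hF : HasDerivAt F F' x) : 0 ≤ F' := by
  by_contra! hneg
  obtain ⟨u, hxu, hu⟩ := mem_nhdsGT_iff_exists_Ioo_subset.1 <| nhdsWithin_le_nhds <|
    eventually_nhdsWithin_sign_eq_of_deriv_neg (hF.deriv.trans_lt hneg)
      (hy.force_eq_zero_of_eq_zero hx)
  obtain ⟨m, hxm, hmu⟩ := exists_between (Set.mem_Ioi.1 hxu)
  obtain ⟨r, hr, hslope⟩ := exists_hasDerivAt_eq_slope (fun r => y r ^ 2 / 2) _ hxm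
    (continuous_of_forall_hasDerivAt hy.deriv_sq).continuousOn fun r _ => hy.deriv_sq r
  have hFr : F r < 0 := by
    have hsign : SignType.sign (F r) = SignType.sign (x - r) := hu ⟨hr.1, hr.2.trans hmu⟩
    rwa [sign_neg (sub_neg.2 hr.1), sign_eq_neg_one_iff] at hsign
  have hrise : 0 ≤ (y m ^ 2 / 2 - y x ^ 2 / 2) / (m - x) := by
    rw [hx]
    exact div_nonneg (by linarith [sq_nonneg (y m)]) (sub_nonneg.2 hxm.le)
  linarith [mul_nonneg hγ (hy.nonneg r)]

end IsOrbitGraph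

/-- The force on the driven pendulum without friction, `x` being the angle. -/
noncomputable abbrev pendulumForce (β : ℝ) : ℝ → ℝ := fun x => β - Real.sin x

section pendulumForce

variable {β : ℝ}

theorem lipschitzWith_pendulumForce : LipschitzWith 1 (pendulumForce β) :=
  zero_add (1 : NNReal) ▸ (LipschitzWith.const β).sub Real.lipschitzWith_sin

theorem periodic_pendulumForce : Function.Periodic (pendulumForce β) (2 * Real.pi) := fun x =>
  congrArg (β - ·) (Real.sin_periodic x)

theorem integral_pendulumForce (a b : ℝ) :
    ∫ x in a..b, pendulumForce β x = β * (b - a) - (Real.cos a - Real.cos b) := by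
  rw [intervalIntegral.integral_sub intervalIntegrable_const
    (Real.continuous_sin.intervalIntegrable _ _), intervalIntegral.integral_const, integral_sin,
    smul_eq_mul, mul_comm]

theorem integral_pendulumForce_period :
    ∫ x in 0..2 * Real.pi, pendulumForce β x = 2 * Real.pi * β := by
  rw [integral_pendulumForce, Real.cos_zero, Real.cos_two_pi]
  ring

theorem integral_pendulumForce_nonneg {s x : ℝ} (hβ : 0 ≤ β) (hs : Real.sin s = β)
    (hcos : Real.cos s ≤ 0) (hsx : s ≤ x) : 0 ≤ ∫ r in s..x, pendulumForce β r := by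
  obtain ⟨u, hu, rfl⟩ := exists_nonneg_add_of_le hsx
  rw [integral_pendulumForce, Real.cos_add, hs]
  linarith [mul_nonneg hβ (sub_nonneg.2 (Real.sin_le hu)),
    mul_nonneg (neg_nonneg.2 hcos) (sub_nonneg.2 (Real.cos_le_one u))]

theorem sin_pi_sub_arcsin (h₀ : 0 ≤ β) (h₁ : β ≤ 1) :
    Real.sin (Real.pi - Real.arcsin β) = β := by
  rw [Real.sin_pi_sub, Real.sin_arcsin (by linarith) h₁]

theorem cos_pi_sub_arcsin (β : ℝ) :
    Real.cos (Real.pi - Real.arcsin β) = -√(1 - β ^ 2) := by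
  rw [Real.cos_pi_sub, Real.cos_arcsin]

theorem eq_pi_sub_arcsin_add_zsmul {x : ℝ} (hcos : Real.cos x ≤ 0) :
    ∃ k : ℤ, x = Real.pi - Real.arcsin (Real.sin x) + k • (2 * Real.pi) := by
  have hangle : (x : Real.Angle) = ↑(Real.pi - Real.arcsin (Real.sin x)) := by
    refine Real.Angle.cos_sin_inj ?_ ?_
    · rw [cos_pi_sub_arcsin, ← Real.abs_cos_eq_sqrt_one_sub_sin_sq, abs_of_nonpos hcos, neg_neg]
    · rw [Real.sin_pi_sub, Real.sin_arcsin (Real.neg_one_le_sin x) (Real.sin_le_one x)]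
  obtain ⟨k, hk⟩ := Real.Angle.angle_eq_iff_two_pi_dvd_sub.1 hangle
  exact ⟨k, by rw [zsmul_eq_mul]; linarith⟩

end pendulumForce

theorem isPendulumSolution_iff {γ β : ℝ} {φ z : ℝ → ℝ} :
    IsPendulumSolution γ β φ z ↔ IsDampedMotion γ (pendulumForce β) φ z :=
  ⟨fun h => ⟨h.deriv_phi, h.deriv_z⟩, fun h => ⟨h.deriv_phi, h.deriv_z⟩⟩

theorem IsOrbitGraph.isPeriodicGraph {γ β : ℝ} {y : ℝ → ℝ}
    (hy : IsOrbitGraph γ (2 * Real.pi) (pendulumForce β) y) (hpos : ∀ x, 0 < y x) :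
    IsPeriodicGraph γ β y :=
  ⟨fun x => (hpos x).ne', fun x => hy.hasDerivAt (hpos x), hy.periodic⟩

namespace IsPeriodicGraph

variable {γ β : ℝ} {y : ℝ → ℝ}

theorem pos (hγ : 0 < γ) (hβ : 0 ≤ β) (hy : IsPeriodicGraph γ β y) (x : ℝ) : 0 < y x := by
  have hcont := continuous_of_forall_hasDerivAt hy.deriv
  by_contra! hle
  have hneg : ∀ r, 0 < -y r := fun r => by
    by_contra! hr
    obtain ⟨m, hm⟩ :=
      mem_range_of_exists_le_of_exists_ge hcont ⟨x, hle⟩ ⟨r, neg_nonpos.1 hr⟩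
    exact hy.ne_zero m hm
  -- The orbit in the lower half plane is an orbit of the time-reversed motion, whose friction
  -- `-γ` would have to be fed by a negative drive.
  have hrev : IsOrbitGraph (-γ) (2 * Real.pi) (pendulumForce β) fun x => -y x :=
    .of_hasDerivAt hneg (fun x => congrArg Neg.neg (hy.periodic x)) fun x =>
      (hy.deriv x).neg.congr_deriv (by rw [div_neg]; ring)
  have hbalance := hrev.integral_force lipschitzWith_pendulumForce.continuous
  have hint : 0 < ∫ x in 0..2 * Real.pi, -y x := intervalIntegral.intervalIntegral_pos_of_pos
    (hcont.neg.intervalIntegrable _ _) hneg Real.two_pi_pos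
  rw [integral_pendulumForce_period] at hbalance
  linarith [mul_pos hγ hint, mul_nonneg Real.two_pi_pos.le hβ]

theorem isOrbitGraph (hγ : 0 < γ) (hβ : 0 ≤ β) (hy : IsPeriodicGraph γ β y) :
    IsOrbitGraph γ (2 * Real.pi) (pendulumForce β) y :=
  .of_hasDerivAt (hy.pos hγ hβ) hy.periodic hy.deriv

end IsPeriodicGraph

theorem IsOrbitGraph.lipschitzWith_pendulum {γ β : ℝ} {y : ℝ → ℝ} (hγ : 0 < γ)
    (hy : IsOrbitGraph γ (2 * Real.pi) (pendulumForce β) y) (hpos : ∀ x, 0 < y x) :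
    LipschitzWith (1 + 2 * γ).toNNReal y :=
  hy.lipschitzWith hγ zero_le_one Real.two_pi_pos.ne' periodic_pendulumForce
    (fun x => (Real.hasDerivAt_sin x).const_sub β)
    (fun x => by simpa using Real.abs_cos_le_one x) hpos

/-- The number `β₀(γ)`: the infimum of the drives that sustain a rotation of the pendulum against
the friction `γ`. -/
noncomputable abbrev pendulumCriticalDrive (γ : ℝ) : ℝ := criticalDrive γ (2 * Real.pi) Real.sin

section Saddles

variable {γ β : ℝ} {y φ z : ℝ → ℝ}

theorem IsOrbitGraph.eq_pi_sub_arcsin_of_eq_zero (hγ : 0 ≤ γ)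
    (hy : IsOrbitGraph γ (2 * Real.pi) (pendulumForce β) y) {x : ℝ} (hx : y x = 0) :
    ∃ k : ℤ, x = Real.pi - Real.arcsin β + k • (2 * Real.pi) := by
  have hcos : 0 ≤ -Real.cos x :=
    hy.deriv_force_nonneg_of_eq_zero hγ hx ((Real.hasDerivAt_sin x).const_sub β)
  rw [sub_eq_zero.1 (hy.force_eq_zero_of_eq_zero hx)]
  exact eq_pi_sub_arcsin_add_zsmul (neg_nonneg.1 hcos)

theorem neg_pi_sub_arcsin_lt (β : ℝ) :
    -Real.pi - Real.arcsin β < Real.pi - Real.arcsin β := by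
  linarith [Real.pi_pos]

theorem IsOrbitGraph.eq_zero_at_saddles (hγ : 0 ≤ γ)
    (hy : IsOrbitGraph γ (2 * Real.pi) (pendulumForce β) y) (hzero : ∃ x, y x = 0) :
    y (-Real.pi - Real.arcsin β) = 0 ∧ y (Real.pi - Real.arcsin β) = 0 := by
  obtain ⟨x, hx⟩ := hzero
  obtain ⟨k, rfl⟩ := hy.eq_pi_sub_arcsin_of_eq_zero hγ hx
  rw [hy.periodic.zsmul k] at hx
  refine ⟨?_, hx⟩
  rw [← hx, ← hy.periodic]
  ring_nf

theorem IsOrbitGraph.pos_between_saddles (hγ : 0 ≤ γ)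
    (hy : IsOrbitGraph γ (2 * Real.pi) (pendulumForce β) y) {x : ℝ}
    (hx : x ∈ Set.Ioo (-Real.pi - Real.arcsin β) (Real.pi - Real.arcsin β)) : 0 < y x := by
  refine (hy.nonneg x).lt_of_ne' fun hzero => ?_
  obtain ⟨k, rfl⟩ := hy.eq_pi_sub_arcsin_of_eq_zero hγ hzero
  rw [zsmul_eq_mul] at hx
  have hk₁ : (-1 : ℝ) < k :=
    lt_of_mul_lt_mul_right (by linarith [hx.1]) Real.two_pi_pos.le
  have hk₀ : (k : ℝ) < 0 :=
    lt_of_mul_lt_mul_right (by linarith [hx.2]) Real.two_pi_pos.le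
  norm_cast at hk₁ hk₀
  omega

end Saddles

section CriticalDrive

variable {γ : ℝ}

theorem exists_saddle_graph (hγ : 0 < γ) :
    ∃ y, IsOrbitGraph γ (2 * Real.pi) (pendulumForce (pendulumCriticalDrive γ)) y ∧
      LipschitzWith (1 + 2 * γ).toNNReal y ∧
      y (-Real.pi - Real.arcsin (pendulumCriticalDrive γ)) = 0 ∧
      y (Real.pi - Real.arcsin (pendulumCriticalDrive γ)) = 0 := by
  obtain ⟨y, hy, hLip, hzero⟩ := exists_critical_graph hγ Real.two_pi_pos zero_le_one
    Real.sin_periodic Real.hasDerivAt_sin fun x => by simpa using Real.abs_cos_le_one x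
  exact ⟨y, hy, hLip, hy.eq_zero_at_saddles hγ.le hzero⟩

theorem pendulumCriticalDrive_pos (hγ : 0 < γ) : 0 < pendulumCriticalDrive γ := by
  obtain ⟨y, hy, -⟩ := exists_saddle_graph hγ
  obtain ⟨x, hx⟩ : ∃ x, pendulumForce (pendulumCriticalDrive γ) x ≠ 0 := by
    by_contra! hforce
    have h₀ := hforce 0
    have h₁ := hforce (Real.pi / 2)
    simp only [pendulumForce, Real.sin_zero, Real.sin_pi_div_two] at h₀ h₁
    linarith
  have hint := hy.integral_force_pos hγ Real.two_pi_pos lipschitzWith_pendulumForce.continuous hx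
  rw [integral_pendulumForce_period] at hint
  exact pos_of_mul_pos_right hint Real.two_pi_pos.le

theorem pendulumCriticalDrive_le_one (hγ : 0 < γ) : pendulumCriticalDrive γ ≤ 1 :=
  criticalDrive_le_of_forall_le hγ Real.two_pi_pos Real.continuous_sin Real.sin_periodic
    Real.sin_le_one

theorem pendulumCriticalDrive_mono {γ' : ℝ} (hγ : 0 < γ) (h : γ ≤ γ') :
    pendulumCriticalDrive γ ≤ pendulumCriticalDrive γ' :=
  criticalDrive_mono hγ Real.two_pi_pos Real.continuous_sin Real.sin_periodic h

theorem exists_isOrbitGraph_pos_iff {β : ℝ} (hγ : 0 < γ) :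
    (∃ y, IsOrbitGraph γ (2 * Real.pi) (pendulumForce β) y ∧ ∀ x, 0 < y x) ↔
      pendulumCriticalDrive γ < β :=
  mem_runningDrives_iff hγ Real.two_pi_pos Real.continuous_sin Real.sin_periodic

end CriticalDrive

namespace IsDepartingTrajectory

variable {γ β : ℝ} {φ z : ℝ → ℝ}

theorem isDampedMotion (h : IsDepartingTrajectory γ β φ z) :
    IsDampedMotion γ (pendulumForce β) φ z :=
  isPendulumSolution_iff.1 h.sol

theorem tendsto_phi (h : IsDepartingTrajectory γ β φ z) :
    Tendsto φ atBot (𝓝 (-Real.pi - Real.arcsin β)) :=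
  h.tendsto_A0.fst_nhds

theorem tendsto_z (h : IsDepartingTrajectory γ β φ z) : Tendsto z atBot (𝓝 0) :=
  h.tendsto_A0.snd_nhds

theorem velocity_pos_of_tendsto (hγ : 0 < γ) (h₀ : 0 ≤ β) (h₁ : β ≤ 1)
    (h : IsDepartingTrajectory γ β φ z)
    (htop : Tendsto (fun t => (φ t, z t)) atTop (𝓝 (saddleA1 β))) (t : ℝ) : 0 < z t :=
  h.isDampedMotion.velocity_pos_of_tendsto hγ lipschitzWith_pendulumForce h.upper htop.fst_nhds
    htop.snd_nhds (fun _ => integral_pendulumForce_nonneg h₀ (sin_pi_sub_arcsin h₀ h₁)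
      ((cos_pi_sub_arcsin β).trans_le (neg_nonpos.2 (Real.sqrt_nonneg _)))) t

theorem runs_into_saddle (hγ : 0 < γ)
    (h : IsDepartingTrajectory γ (pendulumCriticalDrive γ) φ z) :
    (∀ t, 0 < z t) ∧
      Tendsto (fun t => (φ t, z t)) atTop (𝓝 (saddleA1 (pendulumCriticalDrive γ))) := by
  obtain ⟨y, hy, hLip, h₀, h₁⟩ := exists_saddle_graph hγ
  obtain ⟨hpos, hφ, hz⟩ := hy.velocity_pos_and_tendsto_of_departing hγ.le Real.two_pi_pos.ne'
    lipschitzWith_pendulumForce hLip (neg_pi_sub_arcsin_lt _) h₀ h₁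
    (fun _ => hy.pos_between_saddles hγ.le) h.isDampedMotion h.upper h.tendsto_phi h.tendsto_z
  exact ⟨hpos, hφ.prodMk_nhds hz⟩

end IsDepartingTrajectory

theorem isCriticalDrive_pendulumCriticalDrive {γ : ℝ} (hγ : 0 < γ) :
    IsCriticalDrive γ (pendulumCriticalDrive γ) := by
  obtain ⟨y, hy, hLip, h₀, h₁⟩ := exists_saddle_graph hγ
  have hpos := fun x => hy.pos_between_saddles hγ.le (x := x)
  obtain ⟨x₀, hx₀⟩ := exists_between (neg_pi_sub_arcsin_lt (pendulumCriticalDrive γ))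
  obtain ⟨φ, -, hmem, hφ, hbot, htop⟩ :=
    hy.exists_connection Real.two_pi_pos.ne' hLip h₀ h₁ hpos hx₀
  have hlim : ∀ {l : Filter ℝ} {s : ℝ}, y s = 0 → Tendsto φ l (𝓝 s) →
      Tendsto (fun t => (φ t, y (φ t))) l (𝓝 (s, 0)) := fun hs h =>
    h.prodMk_nhds (hs ▸ (hy.continuous.tendsto _).comp h)
  exact ⟨(pendulumCriticalDrive_pos hγ).le, pendulumCriticalDrive_le_one hγ, φ, _,
    ⟨isPendulumSolution_iff.2 hφ, hlim h₀ hbot, .of_forall fun t => hpos _ (hmem t)⟩,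
    hlim h₁ htop⟩

theorem IsCriticalDrive.pendulumCriticalDrive_le {γ β : ℝ} (hγ : 0 < γ)
    (h : IsCriticalDrive γ β) : pendulumCriticalDrive γ ≤ β := by
  obtain ⟨h₀, h₁, φ, z, hdep, htop⟩ := h
  have hpos := hdep.velocity_pos_of_tendsto hγ h₀ h₁ htop
  have hφ := hdep.isDampedMotion
  by_contra! hlt
  obtain ⟨y, hy, -, -, hy₁⟩ := exists_saddle_graph hγ
  have hsaddle := (Real.strictMonoOn_arcsin.lt_iff_lt ⟨by linarith, h₁⟩
    ⟨by linarith, pendulumCriticalDrive_le_one hγ⟩).2 hlt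
  -- The connection at the smaller drive passes above the saddle at which `y` vanishes.
  obtain ⟨t, ht⟩ : Real.pi - Real.arcsin (pendulumCriticalDrive γ) ∈ Set.range φ :=
    mem_range_of_exists_le_of_exists_ge hφ.continuous_phi
      (hdep.tendsto_phi.eventually_le_const (by
        linarith [Real.arcsin_le_pi_div_two (pendulumCriticalDrive γ),
          Real.neg_pi_div_two_le_arcsin β, Real.pi_pos])).exists
      (htop.fst_nhds.eventually_const_le (sub_lt_sub_left hsaddle _)).exists
  have hle := hφ.velocity_le_of_connection hγ (fun x => sub_lt_sub_right hlt _) hy hpos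
    hdep.tendsto_phi hdep.tendsto_z htop.fst_nhds htop.snd_nhds t
  rw [ht, hy₁] at hle
  exact (hpos t).not_ge hle

theorem IsCriticalDrive.le_pendulumCriticalDrive {γ β : ℝ} (hγ : 0 < γ)
    (h : IsCriticalDrive γ β) : β ≤ pendulumCriticalDrive γ := by
  obtain ⟨h₀, h₁, φ, z, hdep, htop⟩ := h
  by_contra! hlt
  obtain ⟨y, hy, hypos⟩ := (exists_isOrbitGraph_pos_iff hγ).2 hlt
  have hφtop : Tendsto φ atTop (𝓝 (-Real.pi - Real.arcsin β + 2 * Real.pi)) := by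
    convert htop.fst_nhds using 2
    simp only [saddleA1]
    ring
  exact (hypos _).ne' <| hdep.isDampedMotion.graph_eq_zero_of_connection hγ hy
    (hdep.velocity_pos_of_tendsto hγ h₀ h₁ htop) hdep.tendsto_phi hdep.tendsto_z hφtop htop.snd_nhds

namespace IsCylinderCycle

variable {γ β : ℝ} {n : ℤ} {φ z y : ℝ → ℝ}

theorem isDampedMotion (h : IsCylinderCycle γ β n φ z) :
    IsDampedMotion γ (pendulumForce β) φ z :=
  isPendulumSolution_iff.1 h.sol

theorem exists_period (h : IsCylinderCycle γ β n φ z) :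
    ∃ S > 0, (∀ t, φ (t + S) = φ t + n • (2 * Real.pi)) ∧ ∀ t, z (t + S) = z t := by
  obtain ⟨S, hS, hper⟩ := h.periodic
  exact ⟨S, hS, fun t => by rw [(hper t).1, zsmul_eq_mul, mul_comm (n : ℝ)], fun t => (hper t).2⟩

theorem exists_velocity_ne_zero (h : IsCylinderCycle γ β n φ z) : ∃ t, z t ≠ 0 := by
  by_contra! hrest
  refine h.nonconstant ⟨φ 0, 0, fun t => ⟨?_, hrest t⟩⟩
  exact is_const_of_deriv_eq_zero (fun s => (h.sol.deriv_phi s).differentiableAt)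
    (fun s => (h.sol.deriv_phi s).deriv.trans (hrest s)) t 0

theorem winding_pos (hγ : 0 < γ) (hβ : 0 ≤ β) (h : IsCylinderCycle γ β n φ z) : 0 < n := by
  obtain ⟨S, hS, hφ, hz⟩ := h.exists_period
  refine h.isDampedMotion.winding_pos hγ lipschitzWith_pendulumForce periodic_pendulumForce ?_
    h.exists_velocity_ne_zero (lt_add_of_pos_right 0 hS) (hφ 0) (hz 0)
  rw [integral_pendulumForce_period]
  exact mul_nonneg Real.two_pi_pos.le hβ

theorem velocity_pos (hγ : 0 < γ) (hβ : 0 ≤ β) (h : IsCylinderCycle γ β n φ z) (t : ℝ) :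
    0 < z t := by
  obtain ⟨S, hS, hφ, -⟩ := h.exists_period
  exact h.isDampedMotion.velocity_pos_of_add_eq_add hγ lipschitzWith_pendulumForce hS
    (zsmul_pos Real.two_pi_pos (h.winding_pos hγ hβ)) hφ t

theorem surjective_phi (hγ : 0 < γ) (hβ : 0 ≤ β) (h : IsCylinderCycle γ β n φ z) :
    Function.Surjective φ := by
  obtain ⟨S, hS, hφ, -⟩ := h.exists_period
  have hcont := h.isDampedMotion.continuous_phi
  obtain ⟨htop, hbot⟩ :=
    tendsto_of_add_eq_add hS (zsmul_pos Real.two_pi_pos (h.winding_pos hγ hβ)) hcont hφ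
  exact hcont.surjective htop hbot

theorem pendulumCriticalDrive_le (hγ : 0 < γ) (hβ : 0 ≤ β) (h : IsCylinderCycle γ β n φ z) :
    pendulumCriticalDrive γ ≤ β := by
  by_contra! hlt
  obtain ⟨y, hy, -, -, hy₁⟩ := exists_saddle_graph hγ
  obtain ⟨S, hS, hφ, hz⟩ := h.exists_period
  obtain ⟨t, ht⟩ := h.surjective_phi hγ hβ (Real.pi - Real.arcsin (pendulumCriticalDrive γ))
  have hbelow := h.isDampedMotion.velocity_lt_of_periodic hγ (fun x => sub_lt_sub_right hlt _) hy
    (h.velocity_pos hγ hβ) hS.ne' hφ hz t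
  rw [ht, hy₁] at hbelow
  exact hbelow.not_gt (h.velocity_pos hγ hβ t)

theorem velocity_eq (hγ : 0 < γ) (hβ : 0 ≤ β) (h : IsCylinderCycle γ β n φ z)
    (hy : IsOrbitGraph γ (2 * Real.pi) (pendulumForce β) y) (t : ℝ) : z t = y (φ t) := by
  obtain ⟨S, hS, hφ, hz⟩ := h.exists_period
  exact h.isDampedMotion.velocity_eq_of_periodic hγ hy (h.velocity_pos hγ hβ) hS hφ hz t

end IsCylinderCycle

theorem IsOrbitGraph.exists_isCylinderCycle {γ β : ℝ} {y : ℝ → ℝ} (hγ : 0 < γ)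
    (hy : IsOrbitGraph γ (2 * Real.pi) (pendulumForce β) y) (hpos : ∀ x, 0 < y x) :
    ∃ φ z, IsCylinderCycle γ β 1 φ z ∧ ∀ t, z t = y (φ t) := by
  obtain ⟨φ, hφ, S, hS, hadd⟩ := exists_flow_add_period Real.two_pi_pos
    (hy.lipschitzWith_pendulum hγ hpos) hy.periodic hpos
  refine ⟨φ, fun t => y (φ t), ⟨isPendulumSolution_iff.2 (hy.isDampedMotion hφ fun _ => hpos _),
    ?_, S, hS, fun t => ⟨by simp [hadd], by simp only [hadd, hy.periodic _]⟩⟩, fun _ => rfl⟩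
  rintro ⟨a, b, hconst⟩
  have hjump := hadd 0
  rw [(hconst _).1, (hconst _).1] at hjump
  linarith [Real.two_pi_pos]

theorem IsOrbitGraph.isStableLimitCycle {γ β : ℝ} {y : ℝ → ℝ} (hγ : 0 < γ)
    (hy : IsOrbitGraph γ (2 * Real.pi) (pendulumForce β) y) (hpos : ∀ x, 0 < y x) :
    IsStableLimitCycle γ β y := by
  obtain ⟨δ, hδ, C, hC, c, hc, hdecay⟩ := hy.exists_infDist_le_exp hγ Real.two_pi_pos.ne'
    (hy.lipschitzWith_pendulum hγ hpos) hpos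
  constructor
  · intro ε hε
    refine ⟨min δ (ε / C), lt_min hδ (div_pos hε hC), fun φ z h hstart t ht => ?_⟩
    have hexp : Real.exp (-c * t) ≤ 1 := Real.exp_le_one_iff.2 (by nlinarith)
    calc Metric.infDist (φ t, z t) (graphCurve y)
        ≤ C * Metric.infDist (φ 0, z 0) (graphCurve y) * Real.exp (-c * t) :=
          hdecay φ z (isPendulumSolution_iff.1 h) (hstart.trans_le (min_le_left _ _)) t ht
      _ ≤ C * Metric.infDist (φ 0, z 0) (graphCurve y) :=
          mul_le_of_le_one_right (mul_nonneg hC.le Metric.infDist_nonneg) hexp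
      _ < ε := (lt_div_iff₀' hC).1 (hstart.trans_le (min_le_right _ _))
  · refine ⟨δ, hδ, fun φ z h hstart => ?_⟩
    have hexp : Tendsto (fun t => Real.exp (-c * t)) atTop (𝓝 0) :=
      Real.tendsto_exp_atBot.comp (tendsto_id.const_mul_atTop_of_neg (neg_neg_of_pos hc))
    have hbound := hexp.const_mul (C * Metric.infDist (φ 0, z 0) (graphCurve y))
    rw [mul_zero] at hbound
    refine squeeze_zero' (.of_forall fun _ => Metric.infDist_nonneg) ?_ hbound
    filter_upwards [eventually_ge_atTop 0] with t ht
    exact hdecay φ z (isPendulumSolution_iff.1 h) hstart t ht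

theorem mainTheorem1 :
    ∃ β₀ : ℝ → ℝ, ∀ γ₁ : ℝ, 0 < γ₁ →
      -- (a) a critical drive exists, and the whole of `R(β₀)` runs above the axis into `A₁`
      ((0 < β₀ γ₁ ∧ β₀ γ₁ ≤ 1 ∧ IsCriticalDrive γ₁ (β₀ γ₁) ∧
        ∀ φ z : ℝ → ℝ, IsDepartingTrajectory γ₁ (β₀ γ₁) φ z →
          (∀ t, 0 < z t) ∧ Tendsto (fun t => (φ t, z t)) atTop (𝓝 (saddleA1 (β₀ γ₁)))) ∧
      -- (b) it is unique
      (∀ β : ℝ, IsCriticalDrive γ₁ β → β = β₀ γ₁) ∧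
      -- (c) above it there is a positive periodic solution, below it there is none
      ((∀ β : ℝ, β₀ γ₁ < β → ∃ zT : ℝ → ℝ, IsPeriodicGraph γ₁ β zT ∧ (∀ x, 0 < zT x) ∧
          ∃ φ z : ℝ → ℝ, IsCylinderCycle γ₁ β 1 φ z ∧ ∀ t, z t = zT (φ t)) ∧
        (∀ β : ℝ, 0 ≤ β → β < β₀ γ₁ →
          (¬ ∃ z : ℝ → ℝ, IsPeriodicGraph γ₁ β z) ∧
          ¬ ∃ (n : ℤ) (φ z : ℝ → ℝ), IsCylinderCycle γ₁ β n φ z)) ∧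
      -- (d) the periodic solution is unique and a stable limit cycle
      (∀ β : ℝ, 0 ≤ β → ∀ zT : ℝ → ℝ, IsPeriodicGraph γ₁ β zT →
        (∀ w : ℝ → ℝ, IsPeriodicGraph γ₁ β w → w = zT) ∧
        (∀ (n : ℤ) (φ z : ℝ → ℝ), IsCylinderCycle γ₁ β n φ z → ∀ t, z t = zT (φ t)) ∧
        IsStableLimitCycle γ₁ β zT) ∧
      -- (e) once the critical drive equals `1`, it stays `1` for larger friction
      (β₀ γ₁ = 1 → ∀ γ₂ : ℝ, γ₁ < γ₂ → β₀ γ₂ = 1)) := by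
  refine ⟨pendulumCriticalDrive, fun γ hγ => ⟨?a, ?b, ⟨?c_above, ?c_below⟩, ?d, ?e⟩⟩
  case a =>
    exact ⟨pendulumCriticalDrive_pos hγ, pendulumCriticalDrive_le_one hγ,
      isCriticalDrive_pendulumCriticalDrive hγ, fun φ z h => h.runs_into_saddle hγ⟩
  case b =>
    exact fun β h => le_antisymm (h.le_pendulumCriticalDrive hγ) (h.pendulumCriticalDrive_le hγ)
  case c_above =>
    intro β hβ
    obtain ⟨y, hy, hpos⟩ := (exists_isOrbitGraph_pos_iff hγ).2 hβ
    exact ⟨y, hy.isPeriodicGraph hpos, hpos, hy.exists_isCylinderCycle hγ hpos⟩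
  case c_below =>
    refine fun β h₀ hβ => ⟨fun ⟨z, hz⟩ => ?_, fun ⟨n, φ, z, h⟩ => ?_⟩
    · exact hβ.not_gt <|
        (exists_isOrbitGraph_pos_iff hγ).1 ⟨z, hz.isOrbitGraph hγ h₀, hz.pos hγ h₀⟩
    · exact hβ.not_ge (h.pendulumCriticalDrive_le hγ h₀)
  case d =>
    intro β h₀ zT hz
    have hy := hz.isOrbitGraph hγ h₀
    exact ⟨fun w hw => (hw.isOrbitGraph hγ h₀).eq hγ Real.two_pi_pos.ne' hy,
      fun n φ z h => h.velocity_eq hγ h₀ hy, hy.isStableLimitCycle hγ (hz.pos hγ h₀)⟩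
  case e =>
    exact fun h γ' hγ' => le_antisymm (pendulumCriticalDrive_le_one (hγ.trans hγ'))
      (h.symm.trans_le (pendulumCriticalDrive_mono hγ hγ'.le))
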